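/- Let $\mathcal H$ be a separable complex Hilbert space and let $\{U(t)\}_{t\ge 0}=\{e^{-tA}\}_{t\ge0}$ be a quasi-bounded $C_0$-semigroup on $\mathcal H$ (that is, $\|U(t)\|\le M e^{\omega_0 t}$ for all $t\ge 0$, with some $M\ge 1$, $\omega_0\in\mathbb R$), such that every $U(t)$ is self-adjoint and $U(t)$ is trace class for every $t>0$ (a self-adjoint Gibbs semigroup). Its generator $A$, given by $Ax=\lim_{t\downarrow0}(x-U(t)x)/t$ on the set of all $x$ for which this limit exists, need not be positive. Let $\|K\|_1$ denote the trace norm (the sum of the singular values of $K$ with multiplicity) and put $F(t):=\|e^{-tA}\|_1$ for $t>0$. For real functions $u,v$ defined for small $t>0$, write $u(t)=O_0(v(t))$ if $v$ does not vanish for small $t>0$ and $\limsup_{t\downarrow0}|u(t)/v(t)|<\infty$, and write $u(t)\sim_{t\downarrow0}v(t)$ if $\lim_{t\downarrow0}|u(t)/v(t)|=1$. Let $\mathcal{SR}$ be the set of functions $f$ that are positive and smooth on some $[a,\infty)$, $a>0$, and for which there is $p>0$ such that $h(x):=\ln f(e^x)$ satisfies $h'(x)\to p$ and $h^{(n)}(x)\to0$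 for all $n\ge2$, as $x\to\infty$. Then $F$ is infinitely differentiable on $(0,\infty)$ and, for every $f\in\mathcal{SR}$, with $g(t):=f(t^{-1})$ for small $t>0$, and every integer $n\ge 0$: (i) if $F(t)=O_0(g(t))$, then $F^{(n)}(t)=O_0(g^{(n)}(t))$; (ii) if $F(t)\sim_{t\downarrow0}g(t)$, then $F^{(n)}(t)\sim_{t\downarrow0}g^{(n)}(t)$. Moreover, for every integer $n\ge0$ and $t>0$, the operator $A^ne^{-tA}$ is everywhere defined, bounded and trace class, and, if $\mathcal H$ is infinite-dimensional, $$F^{(n)}(t)\ \sim_{t\downarrow0}\ \|A^ne^{-tA}\|_1 .$$ -/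

import Mathlib

open Filter Topology Set
open scoped ContDiff ENNReal InnerProductSpace

namespace GibbsSemigroup

section Asymptotics

/-- `f = O(g)` along `l`: `g` does not vanish near the limit point and `|f / g|` stays bounded. -/
def BigO (l : Filter ℝ) (f g : ℝ → ℝ) : Prop :=
  (∀ᶠ t in l, g t ≠ 0) ∧ IsBoundedUnder (· ≤ ·) l (fun t => |f t / g t|)

/-- `f ∼ g` along `l`: `|f / g| → 1`. The limit `1` forces `f` and `g` to be nonzero near the
limit point, so that no division by zero is involved. -/
def Equivalent (l : Filter ℝ) (f g : ℝ → ℝ) : Prop :=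
  Tendsto (fun t => |f t / g t|) l (𝓝 1)

/-- `f` varies smoothly at infinity with index `p`: it is positive and smooth on some `[a, ∞)`
with `a > 0`, and `h x = log (f (exp x))` satisfies `h' → p` and `h⁽ⁿ⁾ → 0` for `n ≥ 2`. -/
def SmoothlyVarying (p : ℝ) (f : ℝ → ℝ) : Prop :=
  ∃ a : ℝ, 0 < a ∧ (∀ x ∈ Ici a, 0 < f x) ∧ ContDiffOn ℝ ∞ f (Ici a) ∧
    Tendsto (iteratedDeriv 1 fun x => Real.log (f (Real.exp x))) atTop (𝓝 p) ∧
    ∀ n : ℕ, 2 ≤ n →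
      Tendsto (iteratedDeriv n fun x => Real.log (f (Real.exp x))) atTop (𝓝 0)

/-- The class of functions that vary smoothly at infinity with some positive index. -/
def SR : Set (ℝ → ℝ) := {f | ∃ p : ℝ, 0 < p ∧ SmoothlyVarying p f}

end Asymptotics

variable {H : Type*} [NormedAddCommGroup H] [InnerProductSpace ℂ H]

section TraceNorm

variable [CompleteSpace H]

/-- The multiplicity of `s` as a singular value of `K`: the dimension of the eigenspace of `K* K`
for the eigenvalue `s ^ 2` (finite if `K` is compact and `s > 0`). -/
noncomputable def singularMultiplicity (K : H →L[ℂ] H) (s : ℝ) : ℕ :=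
  Module.finrank ℂ (Module.End.eigenspace
    ((ContinuousLinearMap.adjoint K ∘L K : H →L[ℂ] H) : H →ₗ[ℂ] H) ((s ^ 2 : ℝ) : ℂ))

/-- The trace norm of a compact operator, with values in `[0, ∞]`: the sum of its nonzero singular
values, counted with multiplicity. -/
noncomputable def traceNorm (K : H →L[ℂ] H) : ℝ≥0∞ :=
  ∑' s : Ioi (0 : ℝ), (singularMultiplicity K s : ℝ≥0∞) * ENNReal.ofReal s

/-- Trace-class operators: compact operators with summable singular values. -/
def IsTraceClass (K : H →L[ℂ] H) : Prop :=
  IsCompactOperator K ∧ traceNorm K < ⊤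

end TraceNorm

/-- `C₀`-semigroups `(U t)`, `t ≥ 0`; the values `U t` for `t < 0` are irrelevant. -/
structure IsC0Semigroup (U : ℝ → H →L[ℂ] H) : Prop where
  zero : U 0 = 1
  add : ∀ s t : ℝ, 0 ≤ s → 0 ≤ t → U (s + t) = U s * U t
  tendsto : ∀ x : H, Tendsto (fun t => U t x) (𝓝[>] 0) (𝓝 x)

/-- Exponential boundedness. -/
def IsQuasiBounded (U : ℝ → H →L[ℂ] H) : Prop :=
  ∃ M ω₀ : ℝ, 1 ≤ M ∧ ∀ t : ℝ, 0 ≤ t → ‖U t‖ ≤ M * Real.exp (ω₀ * t)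

/-- All operators of the semigroup are self-adjoint. -/
def IsSelfAdjointSemigroup [CompleteSpace H] (U : ℝ → H →L[ℂ] H) : Prop :=
  ∀ t : ℝ, 0 ≤ t → IsSelfAdjoint (U t)

/-- A Gibbs semigroup: a `C₀`-semigroup which is trace class for all `t > 0`. -/
def IsGibbs [CompleteSpace H] (U : ℝ → H →L[ℂ] H) : Prop :=
  IsC0Semigroup U ∧ ∀ t : ℝ, 0 < t → IsTraceClass (U t)

/-- The difference quotient `(x - U t x) / t`. -/
noncomputable def diffQuot (U : ℝ → H →L[ℂ] H) (x : H) (t : ℝ) : H :=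
  ((t⁻¹ : ℝ) : ℂ) • (x - U t x)

theorem diffQuot_add (U : ℝ → H →L[ℂ] H) {x y a b : H}
    (hx : Tendsto (diffQuot U x) (𝓝[>] 0) (𝓝 a)) (hy : Tendsto (diffQuot U y) (𝓝[>] 0) (𝓝 b)) :
    Tendsto (diffQuot U (x + y)) (𝓝[>] 0) (𝓝 (a + b)) := by
  refine (hx.add hy).congr fun t => ?_
  simp only [diffQuot, map_add, ← smul_add]
  congr 1
  abel

theorem diffQuot_smul (U : ℝ → H →L[ℂ] H) (c : ℂ) {x a : H}
    (hx : Tendsto (diffQuot U x) (𝓝[>] 0) (𝓝 a)) :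
    Tendsto (diffQuot U (c • x)) (𝓝[>] 0) (𝓝 (c • a)) := by
  refine (hx.const_smul c).congr fun t => ?_
  simp only [diffQuot, map_smul, ← smul_sub]
  rw [smul_comm]

/-- The generator `A` of `U t = e ^ (-t A)`, with the sign convention `A x = lim (x - U t x) / t`
as `t ↓ 0`, on the domain of those `x` for which the limit exists. -/
noncomputable def generator (U : ℝ → H →L[ℂ] H) : H →ₗ.[ℂ] H where
  domain :=
    { carrier := {x | ∃ y, Tendsto (diffQuot U x) (𝓝[>] 0) (𝓝 y)}
      add_mem' := fun ⟨_, ha⟩ ⟨_, hb⟩ => ⟨_, diffQuot_add U ha hb⟩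
      zero_mem' := ⟨0, by
        have h : diffQuot U 0 = fun _ => 0 := by funext t; simp [diffQuot]
        rw [h]
        exact tendsto_const_nhds⟩
      smul_mem' := fun c _ ⟨_, ha⟩ => ⟨_, diffQuot_smul U c ha⟩ }
  toFun :=
    { toFun := fun x => x.2.choose
      map_add' := fun x y => tendsto_nhds_unique (x + y).2.choose_spec
        (diffQuot_add U x.2.choose_spec y.2.choose_spec)
      map_smul' := fun c x => tendsto_nhds_unique (c • x).2.choose_spec
        (diffQuot_smul U c x.2.choose_spec) }

/-- `PowGraph A n x y`: the vector `x` is in the domain of `A ^ n` and `A ^ n x = y`. -/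
def PowGraph (A : H →ₗ.[ℂ] H) : ℕ → H → H → Prop
  | 0, x, y => y = x
  | n + 1, x, y => ∃ z, (x, z) ∈ A.graph ∧ PowGraph A n z y

/-- The function `t ↦ ‖U t‖₁`. -/
noncomputable def traceNormFun [CompleteSpace H] (U : ℝ → H →L[ℂ] H) (t : ℝ) : ℝ :=
  (traceNorm (U t)).toReal

end GibbsSemigroup

/-!
A self-adjoint Gibbs semigroup is diagonal: `U 1` is compact, self-adjoint, positive and injective,
so the spectral theorem gives a Hilbert basis `b` of eigenvectors with eigenvalues `exp (-l i)`. A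
positive operator acts on an eigenvector of its square as the square root of the eigenvalue, so `b`
also diagonalizes `U t` for dyadic `t`, and then for all `t` by right continuity, with eigenvalues
`exp (-l i * t)` (`exists_eigenbasis`). The trace norm of a compact diagonal operator is the sum of
the moduli of its entries (`traceNorm_of_diagonal`). Hence `F t = ∑ exp (-l i * t)`, a series which
may be differentiated termwise, and `A ^ n e ^ (-t A)` is the diagonal operator with entries
`l i ^ n * exp (-l i * t)`, of trace norm `∑ |l i| ^ n * exp (-l i * t)`.

Convergence of the series forces `l i ≤ 0` for only finitely many `i`, and these contribute a
function that is bounded near `t = 0`. The exponents can therefore be replaced by `max (l i) 0`;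
after this, up to the sign `(-1) ^ n`, the derivatives of `F` and the trace norms of
`A ^ n e ^ (-t A)` are the same nonincreasing functions `P n`, with `(P n)' = -P (n + 1)`. If `H` is
infinite-dimensional, then `P n t → ∞` as `t → 0`, which gives the last claim
(`ExpSummable.equivalent_absExpSum`).

For `f` of index `p`, put `h x = log (f (exp x))`, so that `g t = f (1 / t) = exp (h (-log t))`.
Differentiating this formula gives `g⁽ⁿ⁾ t = t ^ (-n) * g t * Q n (-log t)`, where `Q n` is a
polynomial in the derivatives of `h` and tends to `(-1) ^ n * p (p + 1) ⋯ (p + n - 1)`, which is not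
zero (`SmoothlyVarying.atZero`). So everything is compared with `t ^ (-n) * g t`.
For (i), `P n t ≤ n! (2 / t) ^ n * P 0 (t / 2)` and `g (t / 2) = O (g t)`. For (ii), the monotone
density theorem (`tendsto_mul_div_of_antitoneOn`) passes from `P n` to its monotone derivative
`P (n + 1)`, and each step contributes the factor `p + n`.
-/

namespace GibbsSemigroup

/-! ### Diagonal operators and their trace norm -/

section Diagonal

theorem eq_of_forall_inner_eq {E ι : Type*} [NormedAddCommGroup E]
    [InnerProductSpace ℂ E] (b : HilbertBasis ι ℂ E) {x y : E}
    (h : ∀ i, ⟪b i, x⟫_ℂ = ⟪b i, y⟫_ℂ) : x = y := by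
  apply b.repr.injective
  ext i
  simpa [HilbertBasis.repr_apply_apply] using h i

variable {H : Type*} [NormedAddCommGroup H] [InnerProductSpace ℂ H] [CompleteSpace H]

theorem adjoint_apply_of_diagonal {ι : Type*} (b : HilbertBasis ι ℂ H) {K : H →L[ℂ] H}
    {k : ι → ℝ} (h : ∀ i, K (b i) = (k i : ℂ) • b i) (i : ι) :
    ContinuousLinearMap.adjoint K (b i) = (k i : ℂ) • b i := by
  classical
  refine eq_of_forall_inner_eq b fun j => ?_
  rw [ContinuousLinearMap.adjoint_inner_right, h, inner_smul_left, inner_smul_right,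
    Complex.conj_ofReal, orthonormal_iff_ite.mp b.orthonormal]
  split_ifs with hij
  · rw [hij]
  · simp

theorem inner_apply_of_diagonal {ι : Type*} (b : HilbertBasis ι ℂ H) {K : H →L[ℂ] H}
    {k : ι → ℝ} (h : ∀ i, K (b i) = (k i : ℂ) • b i) (i : ι) (x : H) :
    ⟪b i, K x⟫_ℂ = k i * ⟪b i, x⟫_ℂ := by
  rw [← ContinuousLinearMap.adjoint_inner_left, adjoint_apply_of_diagonal b h, inner_smul_left,
    Complex.conj_ofReal]

/-- The eigenspace of `K* K` for `s ^ 2` consists of the vectors that are orthogonal to all basis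
vectors whose diagonal entry is not of modulus `s`. -/
theorem mem_eigenspace_adjoint_comp_self_iff {ι : Type*} (b : HilbertBasis ι ℂ H)
    {K : H →L[ℂ] H} {k : ι → ℝ} (h : ∀ i, K (b i) = (k i : ℂ) • b i) {s : ℝ} (hs : 0 < s) (x : H) :
    x ∈ Module.End.eigenspace
      ((ContinuousLinearMap.adjoint K ∘L K : H →L[ℂ] H) : H →ₗ[ℂ] H) ((s ^ 2 : ℝ) : ℂ) ↔
      ∀ i, |k i| ≠ s → ⟪b i, x⟫_ℂ = 0 := by
  have key (i : ι) : ⟪b i, ContinuousLinearMap.adjoint K (K x)⟫_ℂ =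
      ((k i ^ 2 : ℝ) : ℂ) * ⟪b i, x⟫_ℂ := by
    rw [inner_apply_of_diagonal b (adjoint_apply_of_diagonal b h), inner_apply_of_diagonal b h]
    push_cast
    ring
  rw [Module.End.mem_eigenspace_iff]
  change ContinuousLinearMap.adjoint K (K x) = _ ↔ _
  constructor
  · intro hx i hi
    have h1 := key i
    rw [hx, inner_smul_right] at h1
    by_contra h0
    have h2 : s ^ 2 = k i ^ 2 := by exact_mod_cast mul_right_cancel₀ h0 h1
    exact hi ((abs_eq_abs.mpr (sq_eq_sq_iff_eq_or_eq_neg.mp h2.symm)).trans (abs_of_pos hs))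
  · intro hx
    refine eq_of_forall_inner_eq b fun i => ?_
    rw [key, inner_smul_right]
    by_cases hi : |k i| = s
    · rw [← hi, sq_abs]
    · rw [hx i hi, mul_zero, mul_zero]

/-- For a compact operator that is diagonal in a Hilbert basis, the multiplicity of a singular
value `s` is the number of diagonal entries of modulus `s`. -/
theorem singularMultiplicity_of_diagonal {ι : Type*} (b : HilbertBasis ι ℂ H) {K : H →L[ℂ] H}
    {k : ι → ℝ} (hK : IsCompactOperator K) (h : ∀ i, K (b i) = (k i : ℂ) • b i) {s : ℝ}
    (hs : 0 < s) : (singularMultiplicity K s : ℕ∞) = {i | |k i| = s}.encard := by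
  have hcomp : IsCompactOperator (ContinuousLinearMap.adjoint K ∘L K : H →L[ℂ] H) :=
    hK.clm_comp (ContinuousLinearMap.adjoint K)
  have hfin := ContinuousLinearMap.finite_dimensional_eigenspace hcomp ((s ^ 2 : ℝ) : ℂ)
    (by exact_mod_cast (pow_pos hs 2).ne')
  have hlin : LinearIndependent ℂ (fun i : {i | |k i| = s} => b i) :=
    b.orthonormal.linearIndependent.comp _ Subtype.val_injective
  have hmem (i : {i | |k i| = s}) : b i ∈ Module.End.eigenspace
      ((ContinuousLinearMap.adjoint K ∘L K : H →L[ℂ] H) : H →ₗ[ℂ] H) ((s ^ 2 : ℝ) : ℂ) := by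
    refine (mem_eigenspace_adjoint_comp_self_iff b h hs _).mpr fun j hj => ?_
    refine b.orthonormal.2 fun hij => hj ?_
    rw [hij]
    exact i.2
  have hJ : Finite {i | |k i| = s} := by
    have : LinearIndependent ℂ (fun i : {i | |k i| = s} =>
        (⟨b i, hmem i⟩ : Module.End.eigenspace
          ((ContinuousLinearMap.adjoint K ∘L K : H →L[ℂ] H) : H →ₗ[ℂ] H) ((s ^ 2 : ℝ) : ℂ))) :=
      LinearIndependent.of_comp (Submodule.subtype _) hlin
    exact this.finite
  have := Fintype.ofFinite {i | |k i| = s}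
  have hspan : Module.End.eigenspace
      ((ContinuousLinearMap.adjoint K ∘L K : H →L[ℂ] H) : H →ₗ[ℂ] H) ((s ^ 2 : ℝ) : ℂ)
      = Submodule.span ℂ (range fun i : {i | |k i| = s} => b i) := by
    refine le_antisymm (fun x hx => ?_) (Submodule.span_le.mpr ?_)
    · rw [mem_eigenspace_adjoint_comp_self_iff b h hs] at hx
      have hsum : HasSum (fun i => b.repr x i • b i) (∑ i ∈ (toFinite {i | |k i| = s}).toFinset,
          b.repr x i • b i) := by
        refine hasSum_sum_of_ne_finset_zero fun i hi => ?_
        rw [HilbertBasis.repr_apply_apply, hx i (by simpa using hi), zero_smul]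
      rw [(b.hasSum_repr x).unique hsum]
      refine Submodule.sum_mem _ fun i hi => Submodule.smul_mem _ _ (Submodule.subset_span ?_)
      exact ⟨⟨i, by simpa using hi⟩, rfl⟩
    · rintro _ ⟨i, rfl⟩
      exact hmem i
  rw [singularMultiplicity, hspan, finrank_span_eq_card hlin, ← ENat.card_coe_set_eq,
    ENat.card_eq_coe_fintype_card]

/-- The trace norm of a compact diagonal operator is the sum of the moduli of its entries. -/
theorem traceNorm_of_diagonal {ι : Type*} (b : HilbertBasis ι ℂ H) {K : H →L[ℂ] H}
    {k : ι → ℝ} (hK : IsCompactOperator K) (h : ∀ i, K (b i) = (k i : ℂ) • b i) :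
    traceNorm K = ∑' i, ENNReal.ofReal |k i| := by
  classical
  have h1 (i : ι) : ENNReal.ofReal |k i| =
      ∑' s : Ioi (0 : ℝ), if |k i| = s then ENNReal.ofReal s else 0 := by
    by_cases hi : 0 < |k i|
    · rw [tsum_eq_single ⟨|k i|, hi⟩]
      · simp
      · intro s hs
        rw [if_neg]
        rintro h
        exact hs (Subtype.ext h.symm)
    · have h0 : |k i| = 0 := le_antisymm (not_lt.mp hi) (abs_nonneg _)
      rw [h0, ENNReal.ofReal_zero, eq_comm, ENNReal.tsum_eq_zero]
      intro s
      rw [if_neg s.2.ne]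
  have h2 (s : Ioi (0 : ℝ)) : (singularMultiplicity K s : ℝ≥0∞) * ENNReal.ofReal s =
      ∑' i, if |k i| = s then ENNReal.ofReal s else 0 := by
    have := tsum_subtype {i | |k i| = (s : ℝ)} fun _ => ENNReal.ofReal s
    rw [ENNReal.tsum_set_const, ← singularMultiplicity_of_diagonal b hK h s.2] at this
    simpa [indicator_apply] using this
  rw [traceNorm, tsum_congr h2, ENNReal.tsum_comm]
  exact (tsum_congr h1).symm

/-- The operator with diagonal entries `k i` in the Hilbert basis `b`. The series converges in
operator norm when `k` is summable, which is the only case of interest. -/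
noncomputable def diagonalOperator {ι : Type*} (b : HilbertBasis ι ℂ H) (k : ι → ℝ) : H →L[ℂ] H :=
  ∑' i, (k i : ℂ) • InnerProductSpace.rankOne ℂ (b i) (b i)

variable {ι : Type*} (b : HilbertBasis ι ℂ H) {k : ι → ℝ}

theorem hasSum_diagonalOperator (hk : Summable k) :
    HasSum (fun i => (k i : ℂ) • InnerProductSpace.rankOne ℂ (b i) (b i))
      (diagonalOperator b k) := by
  refine Summable.hasSum (Summable.of_norm ?_)
  simpa [norm_smul, b.orthonormal.1] using hk.abs

theorem hasSum_diagonalOperator_apply (hk : Summable k) (x : H) :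
    HasSum (fun i => ((k i : ℂ) * ⟪b i, x⟫_ℂ) • b i) (diagonalOperator b k x) := by
  simpa [mul_smul] using
    (ContinuousLinearMap.apply ℂ H x).hasSum (hasSum_diagonalOperator b hk)

theorem diagonalOperator_apply_basis (hk : Summable k) (i : ι) :
    diagonalOperator b k (b i) = (k i : ℂ) • b i := by
  classical
  refine (hasSum_diagonalOperator_apply b hk (b i)).unique ?_
  convert hasSum_single (f := fun j => ((k j : ℂ) * ⟪b j, b i⟫_ℂ) • b j) i ?_ using 1
  · simp [b.orthonormal.1]
  · intro j hj
    simp [b.orthonormal.2 hj]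

theorem isCompactOperator_rankOne {E : Type*} [NormedAddCommGroup E] [InnerProductSpace ℂ E]
    (x y : E) :
    IsCompactOperator (InnerProductSpace.rankOne ℂ x y : E →L[ℂ] E) := by
  have : IsCompactOperator (ContinuousLinearMap.toSpanSingleton ℂ x) :=
    isCompactOperator_of_locallyCompactSpace_rng _
  rw [InnerProductSpace.rankOne_def']
  exact this.comp_clm (innerSL ℂ y)

theorem isCompactOperator_diagonalOperator (hk : Summable k) :
    IsCompactOperator (diagonalOperator b k) := by
  refine isCompactOperator_of_tendsto (hasSum_diagonalOperator b hk)
    (Eventually.of_forall fun s => ?_)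
  exact Submodule.sum_mem (compactOperator (RingHom.id ℂ) H H) fun i _ =>
    Submodule.smul_mem _ _ (isCompactOperator_rankOne (b i) (b i))

theorem eq_diagonalOperator {K : H →L[ℂ] H} (hk : Summable k)
    (h : ∀ i, K (b i) = (k i : ℂ) • b i) : K = diagonalOperator b k := by
  ext x
  refine eq_of_forall_inner_eq b fun i => ?_
  rw [inner_apply_of_diagonal b h,
    inner_apply_of_diagonal b (fun i => diagonalOperator_apply_basis b hk i)]

theorem isTraceClass_diagonalOperator (hk : Summable k) :
    IsTraceClass (diagonalOperator b k) := by
  have hc := isCompactOperator_diagonalOperator b hk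
  refine ⟨hc, ?_⟩
  rw [traceNorm_of_diagonal b hc (diagonalOperator_apply_basis b hk)]
  exact hk.abs.tsum_ofReal_lt_top

theorem traceNorm_diagonalOperator_toReal (hk : Summable k) :
    (traceNorm (diagonalOperator b k)).toReal = ∑' i, |k i| := by
  rw [traceNorm_of_diagonal b (isCompactOperator_diagonalOperator b hk)
    (diagonalOperator_apply_basis b hk), ← ENNReal.ofReal_tsum_of_nonneg (fun i => abs_nonneg _)
    hk.abs, ENNReal.toReal_ofReal (tsum_nonneg fun i => abs_nonneg _)]

end Diagonal

/-! ### The eigenbasis of a self-adjoint Gibbs semigroup -/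

section Eigenbasis

variable {H : Type*} [NormedAddCommGroup H] [InnerProductSpace ℂ H]

theorem IsC0Semigroup.half_half {U : ℝ → H →L[ℂ] H} (hU : IsC0Semigroup U) {t : ℝ} (ht : 0 ≤ t)
    (x : H) : U (t / 2) (U (t / 2) x) = U t x := by
  conv_rhs => rw [← add_halves t, hU.add _ _ (by positivity) (by positivity)]
  rfl

theorem IsC0Semigroup.apply_nat_mul {U : ℝ → H →L[ℂ] H} (hU : IsC0Semigroup U)
    {x : H} {l s : ℝ} (hs : 0 ≤ s) (h : U s x = (Real.exp (-(l * s)) : ℂ) • x) (k : ℕ) :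
    U (k * s) x = (Real.exp (-(l * (k * s))) : ℂ) • x := by
  induction k with
  | zero => simp [hU.zero]
  | succ k ih =>
    have h1 : U ((k + 1 : ℕ) * s) x = U (k * s) (U s x) := by
      have : ((k + 1 : ℕ) : ℝ) * s = k * s + s := by push_cast; ring
      rw [this, hU.add _ _ (by positivity) hs]
      rfl
    rw [h1, h, map_smul, ih, smul_smul, ← Complex.ofReal_mul, ← Real.exp_add]
    congr 3
    push_cast
    ring

/-- If `x` is an eigenvector of all `U (2 ^ (-n))` with exponential eigenvalues, then it is one of
all `U t`, by right continuity: every `t` is a limit of dyadic numbers from the right. -/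
theorem IsC0Semigroup.apply_of_forall_dyadic {U : ℝ → H →L[ℂ] H} (hU : IsC0Semigroup U)
    {x : H} {l : ℝ} (h : ∀ n : ℕ, U ((1 / 2) ^ n) x = (Real.exp (-(l * (1 / 2) ^ n)) : ℂ) • x)
    {t : ℝ} (ht : 0 ≤ t) : U t x = (Real.exp (-(l * t)) : ℂ) • x := by
  set d : ℕ → ℝ := fun n => ((⌊2 ^ n * t⌋₊ + 1 : ℕ) : ℝ) * (1 / 2) ^ n with hd
  have hpow (n : ℕ) : (2 : ℝ) ^ n * (1 / 2) ^ n = 1 := by rw [← mul_pow]; norm_num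
  have hlt (n : ℕ) : t < d n := by
    have h1 := Nat.lt_floor_add_one (2 ^ n * t)
    have h2 := mul_lt_mul_of_pos_right h1 (show (0 : ℝ) < (1 / 2) ^ n by positivity)
    calc t = 2 ^ n * t * (1 / 2) ^ n := by linear_combination (-t) * hpow n
      _ < _ := by simpa [hd] using h2
  have hle (n : ℕ) : d n ≤ t + (1 / 2) ^ n := by
    have h1 := Nat.floor_le (show 0 ≤ 2 ^ n * t by positivity)
    have h2 := mul_le_mul_of_nonneg_right h1 (show (0 : ℝ) ≤ (1 / 2) ^ n by positivity)
    have h3 : 2 ^ n * t * (1 / 2) ^ n = t := by linear_combination t * hpow n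
    simp only [hd]
    push_cast
    linarith
  have hd0 : Tendsto (fun n => d n - t) atTop (𝓝[>] 0) := by
    refine tendsto_nhdsWithin_iff.mpr ⟨?_, Eventually.of_forall fun n => sub_pos.mpr (hlt n)⟩
    exact squeeze_zero (fun n => (sub_pos.mpr (hlt n)).le) (fun n => by linarith [hle n])
      (tendsto_pow_atTop_nhds_zero_of_lt_one (by norm_num) (by norm_num : (1 / 2 : ℝ) < 1))
  have hdt : Tendsto d atTop (𝓝 t) := by
    simpa using (tendsto_nhds_of_tendsto_nhdsWithin hd0).add_const t
  have hl : Tendsto (fun n => U (d n) x) atTop (𝓝 (U t x)) := by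
    refine (((U t).continuous.tendsto x).comp ((hU.tendsto x).comp hd0)).congr fun n => ?_
    have : U (d n) = U t * U (d n - t) := by
      rw [← hU.add _ _ ht (sub_pos.mpr (hlt n)).le, add_sub_cancel]
    rw [this]
    rfl
  have hr : Tendsto (fun n => U (d n) x) atTop (𝓝 ((Real.exp (-(l * t)) : ℂ) • x)) := by
    have hc : Continuous fun s : ℝ => (Real.exp (-(l * s)) : ℂ) • x := by fun_prop
    refine ((hc.tendsto t).comp hdt).congr fun n => ?_
    exact (hU.apply_nat_mul (by positivity) (h n) _).symm
  exact tendsto_nhds_unique hl hr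

variable [CompleteSpace H]

theorem IsC0Semigroup.re_inner_nonneg {U : ℝ → H →L[ℂ] H} (hU : IsC0Semigroup U)
    (hsa : IsSelfAdjointSemigroup U) {t : ℝ} (ht : 0 ≤ t) (x : H) :
    0 ≤ RCLike.re ⟪x, U t x⟫_ℂ := by
  rw [← hU.half_half ht, ← ContinuousLinearMap.adjoint_inner_left,
    (ContinuousLinearMap.isSelfAdjoint_iff'.mp (hsa _ (by positivity))), inner_self_eq_norm_sq]
  positivity

/-- The operators `U t` are injective: `U t x = 0` implies `‖U (t / 2) x‖ ^ 2 = 0`, and repeated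
halving together with strong continuity at `0` gives `x = 0`. -/
theorem IsC0Semigroup.injective {U : ℝ → H →L[ℂ] H} (hU : IsC0Semigroup U)
    (hsa : IsSelfAdjointSemigroup U) {t : ℝ} (ht : 0 < t) {x : H} (hx : U t x = 0) : x = 0 := by
  have h (n : ℕ) : U (t * (1 / 2) ^ n) x = 0 := by
    induction n with
    | zero => simpa using hx
    | succ n ih =>
      rw [pow_succ, ← mul_assoc, mul_one_div]
      have h0 : 0 ≤ t * (1 / 2) ^ n := by positivity
      rw [← inner_self_eq_zero (𝕜 := ℂ), ← ContinuousLinearMap.adjoint_inner_left,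
        (ContinuousLinearMap.isSelfAdjoint_iff'.mp (hsa _ (by positivity))),
        hU.half_half h0, ih, inner_zero_left]
  have hlim : Tendsto (fun n : ℕ => t * (1 / 2 : ℝ) ^ n) atTop (𝓝[>] 0) := by
    refine tendsto_nhdsWithin_iff.mpr ⟨?_, Eventually.of_forall fun n => ?_⟩
    · simpa using (tendsto_pow_atTop_nhds_zero_of_lt_one (by norm_num)
        (by norm_num : (1 / 2 : ℝ) < 1)).const_mul t
    · exact mul_pos ht (by positivity)
  exact tendsto_nhds_unique ((hU.tendsto x).comp hlim)
    (tendsto_const_nhds.congr fun n => (h n).symm)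

/-- The positive operator `U (t / 2)` acts on an eigenvector of its square `U t` as the square root
of the eigenvalue. -/
theorem IsC0Semigroup.apply_half {U : ℝ → H →L[ℂ] H} (hU : IsC0Semigroup U)
    (hsa : IsSelfAdjointSemigroup U) {t : ℝ} (ht : 0 ≤ t) {x : H} {l : ℝ}
    (h : U t x = (Real.exp (-(l * t)) : ℂ) • x) :
    U (t / 2) x = (Real.exp (-(l * (t / 2))) : ℂ) • x := by
  set r := Real.exp (-(l * (t / 2))) with hr
  have hrr : (Real.exp (-(l * t)) : ℂ) = r * r := by
    rw [← Complex.ofReal_mul, hr, ← Real.exp_add]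
    congr 2
    ring
  set y := U (t / 2) x - (r : ℂ) • x with hy
  -- `y` is an eigenvector of a positive operator for a negative eigenvalue.
  have hUy : U (t / 2) y = -(r : ℂ) • y := by
    rw [hy, map_sub, map_smul, hU.half_half ht, h, hrr]
    module
  have h0 := hU.re_inner_nonneg hsa (t := t / 2) (by positivity) y
  rw [hUy, inner_smul_right, ← Complex.ofReal_neg] at h0
  have h1 : RCLike.re (((-r : ℝ) : ℂ) * ⟪y, y⟫_ℂ) = -r * ‖y‖ ^ 2 := by
    rw [← inner_self_eq_norm_sq (𝕜 := ℂ) y]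
    exact Complex.re_ofReal_mul _ _
  rw [h1] at h0
  have h2 : ‖y‖ ^ 2 ≤ 0 := by nlinarith [Real.exp_pos (-(l * (t / 2)))]
  have h3 : y = 0 := by
    rw [← norm_eq_zero]
    exact pow_eq_zero_iff two_ne_zero |>.mp (le_antisymm h2 (sq_nonneg _))
  exact sub_eq_zero.mp h3

theorem IsC0Semigroup.apply_of_apply_one {U : ℝ → H →L[ℂ] H} (hU : IsC0Semigroup U)
    (hsa : IsSelfAdjointSemigroup U) {x : H} {l : ℝ} (h : U 1 x = (Real.exp (-l) : ℂ) • x)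
    {t : ℝ} (ht : 0 ≤ t) : U t x = (Real.exp (-(l * t)) : ℂ) • x := by
  refine hU.apply_of_forall_dyadic (fun n => ?_) ht
  induction n with
  | zero => simpa using h
  | succ n ih =>
    rw [pow_succ, mul_one_div]
    exact hU.apply_half hsa (by positivity) ih

/-- A self-adjoint Gibbs semigroup is diagonal in some Hilbert basis: the spectral theorem gives an
eigenbasis of the compact operator `U 1`, which consists of eigenvectors of every `U t`. -/
theorem exists_eigenbasis {U : ℝ → H →L[ℂ] H} (hG : IsGibbs U) (hsa : IsSelfAdjointSemigroup U) :
    ∃ (ι : Type) (b : HilbertBasis ι ℂ H) (l : ι → ℝ), ∀ (t : ℝ), 0 ≤ t → ∀ i,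
      U t (b i) = (Real.exp (-(l i * t)) : ℂ) • b i := by
  have hU := hG.1
  have hc : IsCompactOperator (U 1) := (hG.2 1 one_pos).1
  have hsymm : (U 1).IsSymmetric := (hsa 1 zero_le_one).isSymmetric
  have hfd (μ : ℂ) : FiniteDimensional ℂ (Module.End.eigenspace (U 1 : H →ₗ[ℂ] H) μ) := by
    by_cases hμ : μ = 0
    · have : Module.End.eigenspace (U 1 : H →ₗ[ℂ] H) μ = ⊥ := by
        rw [Submodule.eq_bot_iff]
        intro x hx
        rw [Module.End.mem_eigenspace_iff, hμ, zero_smul] at hx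
        exact hU.injective hsa one_pos hx
      rw [this]
      infer_instance
    · exact ContinuousLinearMap.finite_dimensional_eigenspace hc μ hμ
  set v : (Σ μ : ℂ, Fin (Module.finrank ℂ (Module.End.eigenspace (U 1 : H →ₗ[ℂ] H) μ))) → H :=
    fun a => (stdOrthonormalBasis ℂ (Module.End.eigenspace (U 1 : H →ₗ[ℂ] H) a.1) a.2 : H) with hv
  have hvo : Orthonormal ℂ v := hsymm.orthogonalFamily_eigenspaces.orthonormal_sigma_orthonormal
    (v_family := fun μ => stdOrthonormalBasis ℂ (Module.End.eigenspace (U 1 : H →ₗ[ℂ] H) μ))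
    fun μ => (stdOrthonormalBasis ℂ _).orthonormal
  have hspan : (Submodule.span ℂ (range v))ᗮ = ⊥ := by
    rw [eq_bot_iff, ← ContinuousLinearMap.orthogonalComplement_iSup_eigenspaces_eq_bot hc hsymm]
    refine Submodule.orthogonal_le (iSup_le fun μ x hx => ?_)
    have := (stdOrthonormalBasis ℂ (Module.End.eigenspace (U 1 : H →ₗ[ℂ] H) μ)).sum_repr ⟨x, hx⟩
    have h2 := congrArg (Submodule.subtype _) this
    rw [map_sum] at h2
    rw [show x = Submodule.subtype _ ⟨x, hx⟩ from rfl, ← h2]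
    refine Submodule.sum_mem _ fun j _ => ?_
    rw [map_smul]
    exact Submodule.smul_mem _ _ (Submodule.subset_span ⟨⟨μ, j⟩, rfl⟩)
  have hex (a) : ∃ l : ℝ, U 1 (v a) = (Real.exp (-l) : ℂ) • v a := by
    have hmem : U 1 (v a) = a.1 • v a := Module.End.mem_eigenspace_iff.mp
      (stdOrthonormalBasis ℂ (Module.End.eigenspace (U 1 : H →ₗ[ℂ] H) a.1) a.2).2
    have hne : v a ≠ 0 := hvo.ne_zero a
    have hev : Module.End.HasEigenvalue (U 1 : H →ₗ[ℂ] H) a.1 :=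
      Module.End.hasEigenvalue_of_hasEigenvector
        (Module.End.hasEigenvector_iff.mpr ⟨Module.End.mem_eigenspace_iff.mpr hmem, hne⟩)
    have hreal : ((a.1.re : ℝ) : ℂ) = a.1 :=
      Complex.conj_eq_iff_re.mp (hsymm.conj_eigenvalue_eq_self hev)
    have hnn : 0 ≤ a.1.re := by
      rw [← hreal] at hev
      exact eigenvalue_nonneg_of_nonneg hev (hU.re_inner_nonneg hsa zero_le_one)
    have hpos : 0 < a.1.re := by
      refine lt_of_le_of_ne hnn fun h0 => hne (hU.injective hsa one_pos ?_)
      rw [hmem, ← hreal, ← h0, Complex.ofReal_zero, zero_smul]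
    refine ⟨-Real.log a.1.re, ?_⟩
    rw [neg_neg, Real.exp_log hpos, hmem, hreal]
  choose l hl using hex
  refine ⟨_, HilbertBasis.mkOfOrthogonalEqBot hvo hspan, l, fun t ht i => ?_⟩
  rw [HilbertBasis.coe_mkOfOrthogonalEqBot]
  exact hU.apply_of_apply_one hsa (hl i) ht

end Eigenbasis

/-! ### Exponential sums -/

section ExpSum

open Asymptotics

variable {ι : Type*}

/-- The series `∑ (-l i) ^ n * exp (-l i * t)`, the formal `n`-th derivative of
`t ↦ ∑ exp (-l i * t)`. -/
noncomputable def expSum (l : ι → ℝ) (n : ℕ) (t : ℝ) : ℝ :=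
  ∑' i, (-l i) ^ n * Real.exp (-(l i * t))

/-- The series `∑ |l i| ^ n * exp (-l i * t)` of the absolute values of the terms of `expSum`. -/
noncomputable def absExpSum (l : ι → ℝ) (n : ℕ) (t : ℝ) : ℝ :=
  ∑' i, |l i| ^ n * Real.exp (-(l i * t))

/-- All sums `∑ exp (-l i * t)` with `t > 0` converge. -/
def ExpSummable (l : ι → ℝ) : Prop :=
  ∀ t : ℝ, 0 < t → Summable fun i => Real.exp (-(l i * t))

theorem pow_mul_exp_neg_le {x t : ℝ} (hx : 0 ≤ x) (ht : 0 < t) (n : ℕ) :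
    x ^ n * Real.exp (-(x * t)) ≤ n.factorial * (2 / t) ^ n * Real.exp (-(x * (t / 2))) := by
  have h1 := Real.pow_div_factorial_le_exp (x * (t / 2)) (by positivity) n
  rw [div_le_iff₀ (by positivity)] at h1
  have h2 : Real.exp (-(x * t)) = Real.exp (-(x * (t / 2))) * Real.exp (-(x * (t / 2))) := by
    rw [← Real.exp_add]
    ring_nf
  have h3 : x ^ n = (2 / t) ^ n * (x * (t / 2)) ^ n := by
    rw [← mul_pow]
    field_simp
  have h4 : Real.exp (x * (t / 2)) * Real.exp (-(x * (t / 2))) = 1 := by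
    rw [← Real.exp_add, add_neg_cancel, Real.exp_zero]
  calc x ^ n * Real.exp (-(x * t))
      = (2 / t) ^ n * Real.exp (-(x * (t / 2))) *
        ((x * (t / 2)) ^ n * Real.exp (-(x * (t / 2)))) := by
        rw [h2, h3]
        ring
    _ ≤ (2 / t) ^ n * Real.exp (-(x * (t / 2))) *
        ((Real.exp (x * (t / 2)) * n.factorial) * Real.exp (-(x * (t / 2)))) := by gcongr
    _ = (2 / t) ^ n * Real.exp (-(x * (t / 2))) * n.factorial *
        (Real.exp (x * (t / 2)) * Real.exp (-(x * (t / 2)))) := by ring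
    _ = _ := by
        rw [h4]
        ring

namespace ExpSummable

variable {l : ι → ℝ}

theorem finite_le (hl : ExpSummable l) (c : ℝ) : {i | l i ≤ c}.Finite := by
  have h := (hl 1 one_pos).tendsto_cofinite_zero.eventually_lt_const (Real.exp_pos (-c))
  refine (eventually_cofinite.mp h).subset fun i hi => ?_
  simpa using hi

theorem summable_abs (hl : ExpSummable l) (n : ℕ) {t : ℝ} (ht : 0 < t) :
    Summable fun i => |l i| ^ n * Real.exp (-(l i * t)) := by
  refine ((hl (t / 2) (half_pos ht)).mul_left (n.factorial * (2 / t) ^ n)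
    ).of_norm_bounded_eventually ?_
  filter_upwards [(hl.finite_le 0).compl_mem_cofinite] with i hi
  have hi0 : 0 < l i := by simpa using hi
  rw [Real.norm_of_nonneg (by positivity), abs_of_pos hi0]
  exact pow_mul_exp_neg_le hi0.le ht n

theorem summable (hl : ExpSummable l) (n : ℕ) {t : ℝ} (ht : 0 < t) :
    Summable fun i => (-l i) ^ n * Real.exp (-(l i * t)) := by
  refine (hl.summable_abs n ht).of_norm_bounded fun i => ?_
  rw [norm_mul, norm_pow, norm_neg, Real.norm_eq_abs, Real.norm_of_nonneg (Real.exp_pos _).le]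

theorem summable_pow (hl : ExpSummable l) (n : ℕ) {t : ℝ} (ht : 0 < t) :
    Summable fun i => l i ^ n * Real.exp (-(l i * t)) := by
  refine (hl.summable_abs n ht).of_norm_bounded fun i => ?_
  rw [norm_mul, norm_pow, Real.norm_eq_abs, Real.norm_of_nonneg (Real.exp_pos _).le]

theorem hasDerivAt (hl : ExpSummable l) (n : ℕ) {t : ℝ} (ht : 0 < t) :
    HasDerivAt (expSum l n) (expSum l (n + 1) t) t := by
  have hmem : t ∈ Ioo (t / 2) (2 * t) := ⟨by linarith, by linarith⟩
  have hterm (i : ι) (y : ℝ) : HasDerivAt (fun z => (-l i) ^ n * Real.exp (-(l i * z)))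
      ((-l i) ^ (n + 1) * Real.exp (-(l i * y))) y := by
    have h := (((hasDerivAt_id y).const_mul (l i)).fun_neg.exp).const_mul ((-l i) ^ n)
    refine h.congr_deriv ?_
    simp only [id]
    ring
  refine hasDerivAt_tsum_of_isPreconnected
    (g := fun i z => (-l i) ^ n * Real.exp (-(l i * z)))
    (g' := fun i z => (-l i) ^ (n + 1) * Real.exp (-(l i * z)))
    (u := fun i => |l i| ^ (n + 1) * Real.exp (-(l i * (t / 2))) +
      |l i| ^ (n + 1) * Real.exp (-(l i * (2 * t))))
    ((hl.summable_abs _ (by positivity)).add (hl.summable_abs _ (by positivity)))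
    isOpen_Ioo isPreconnected_Ioo (fun i y _ => hterm i y) (fun i y hy => ?_) hmem
    (hl.summable n ht) hmem
  rw [norm_mul, norm_pow, norm_neg, Real.norm_eq_abs, Real.norm_of_nonneg (Real.exp_pos _).le,
    ← mul_add]
  refine mul_le_mul_of_nonneg_left ?_ (by positivity)
  -- `exp (-l y)` is monotone in `y`, with a direction that depends on the sign of `l`.
  rcases le_total 0 (l i) with h | h
  · have : Real.exp (-(l i * y)) ≤ Real.exp (-(l i * (t / 2))) :=
      Real.exp_le_exp.mpr (neg_le_neg (mul_le_mul_of_nonneg_left hy.1.le h))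
    linarith [Real.exp_pos (-(l i * (2 * t)))]
  · have : Real.exp (-(l i * y)) ≤ Real.exp (-(l i * (2 * t))) :=
      Real.exp_le_exp.mpr (neg_le_neg (mul_le_mul_of_nonpos_left hy.2.le h))
    linarith [Real.exp_pos (-(l i * (t / 2)))]

theorem iteratedDeriv_eq (hl : ExpSummable l) {F : ℝ → ℝ} (hF : ∀ t, 0 < t → F t = expSum l 0 t)
    (n : ℕ) {t : ℝ} (ht : 0 < t) : iteratedDeriv n F t = expSum l n t := by
  induction n generalizing t with
  | zero => simpa using hF t ht
  | succ n ih =>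
    have : iteratedDeriv n F =ᶠ[𝓝 t] expSum l n := by
      filter_upwards [Ioi_mem_nhds ht] with s hs using ih hs
    rw [iteratedDeriv_succ, this.deriv_eq, (hl.hasDerivAt n ht).deriv]

theorem contDiffOn (hl : ExpSummable l) {F : ℝ → ℝ} (hF : ∀ t, 0 < t → F t = expSum l 0 t) :
    ContDiffOn ℝ ∞ F (Ioi 0) := by
  refine contDiffOn_of_differentiableOn_deriv fun m _ => ?_
  have h : EqOn (iteratedDerivWithin m F (Ioi 0)) (expSum l m) (Ioi 0) := fun t ht => by
    rw [iteratedDerivWithin_of_isOpen isOpen_Ioi ht, hl.iteratedDeriv_eq hF m ht]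
  exact DifferentiableOn.congr
    (fun t ht => (hl.hasDerivAt m ht).differentiableAt.differentiableWithinAt) h

/-- The positive parts `max (l i) 0` differ from `l i` for finitely many `i` only. -/
theorem posPart (hl : ExpSummable l) : ExpSummable fun i => max (l i) 0 := by
  refine fun t ht => (summable_congr_cofinite ?_).mp (hl t ht)
  filter_upwards [(hl.finite_le 0).compl_mem_cofinite] with i hi
  have hi0 : 0 < l i := by simpa using hi
  rw [max_eq_left hi0.le]

end ExpSummable

/-- Two series whose terms differ for finitely many indices only differ by a bounded function
near `0`. -/
theorem tsum_sub_tsum_isBigO_one {a b : ι → ℝ → ℝ} (ha : ∀ i, Continuous (a i))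
    (hb : ∀ i, Continuous (b i)) (has : ∀ t, 0 < t → Summable fun i => a i t)
    (hbs : ∀ t, 0 < t → Summable fun i => b i t) {s : Set ι} (hs : s.Finite)
    (h : ∀ i ∉ s, a i = b i) :
    (fun t => ∑' i, a i t - ∑' i, b i t) =O[𝓝[>] 0] (fun _ => (1 : ℝ)) := by
  have hcont : Continuous fun t => ∑ i ∈ hs.toFinset, (a i t - b i t) :=
    continuous_finsetSum _ fun i _ => (ha i).sub (hb i)
  refine ((hcont.tendsto 0).mono_left nhdsWithin_le_nhds).isBigO_one ℝ |>.congr' ?_ .rfl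
  filter_upwards [self_mem_nhdsWithin] with t ht
  rw [← (has t ht).tsum_sub (hbs t ht), tsum_eq_sum]
  intro i hi
  rw [h i (by simpa using hi), sub_self]

namespace ExpSummable

variable {l : ι → ℝ}

theorem expSum_sub_isBigO_one (hl : ExpSummable l) (n : ℕ) :
    (fun t => expSum l n t - expSum (fun i => max (l i) 0) n t) =O[𝓝[>] 0]
      (fun _ => (1 : ℝ)) := by
  refine tsum_sub_tsum_isBigO_one (a := fun i t => (-l i) ^ n * Real.exp (-(l i * t)))
    (b := fun i t => (-max (l i) 0) ^ n * Real.exp (-(max (l i) 0 * t)))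
    (fun i => by fun_prop) (fun i => by fun_prop) (fun t ht => hl.summable n ht)
    (fun t ht => hl.posPart.summable n ht) (hl.finite_le 0) fun i hi => ?_
  have hi0 : 0 < l i := by simpa using hi
  simp only [max_eq_left hi0.le]

theorem absExpSum_sub_isBigO_one (hl : ExpSummable l) (n : ℕ) :
    (fun t => absExpSum l n t - absExpSum (fun i => max (l i) 0) n t) =O[𝓝[>] 0]
      (fun _ => (1 : ℝ)) := by
  refine tsum_sub_tsum_isBigO_one (a := fun i t => |l i| ^ n * Real.exp (-(l i * t)))
    (b := fun i t => |max (l i) 0| ^ n * Real.exp (-(max (l i) 0 * t)))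
    (fun i => by fun_prop) (fun i => by fun_prop) (fun t ht => hl.summable_abs n ht)
    (fun t ht => hl.posPart.summable_abs n ht) (hl.finite_le 0) fun i hi => ?_
  have hi0 : 0 < l i := by simpa using hi
  simp only [max_eq_left hi0.le]

end ExpSummable

section Nonneg

variable {l : ι → ℝ}

theorem expSum_eq_neg_one_pow_mul (h0 : ∀ i, 0 ≤ l i) (n : ℕ) (t : ℝ) :
    expSum l n t = (-1) ^ n * absExpSum l n t := by
  rw [expSum, absExpSum, ← tsum_mul_left]
  refine tsum_congr fun i => ?_
  rw [abs_of_nonneg (h0 i), neg_pow, mul_assoc]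

theorem absExpSum_nonneg (l : ι → ℝ) (n : ℕ) (t : ℝ) : 0 ≤ absExpSum l n t :=
  tsum_nonneg fun _ => by positivity

theorem absExpSum_antitoneOn (hl : ExpSummable l) (h0 : ∀ i, 0 ≤ l i) (n : ℕ) :
    AntitoneOn (absExpSum l n) (Ioi 0) := by
  intro s hs t ht hst
  refine (hl.summable_abs n ht).tsum_le_tsum (fun i => ?_) (hl.summable_abs n hs)
  have := h0 i
  gcongr

theorem hasDerivAt_absExpSum (hl : ExpSummable l) (h0 : ∀ i, 0 ≤ l i) (n : ℕ) {t : ℝ}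
    (ht : 0 < t) : HasDerivAt (absExpSum l n) (-absExpSum l (n + 1) t) t := by
  have h1 : absExpSum l n = fun t => (-1) ^ n * expSum l n t := by
    funext t
    rw [expSum_eq_neg_one_pow_mul h0, ← mul_assoc, ← mul_pow]
    norm_num
  rw [h1]
  refine ((hl.hasDerivAt n ht).const_mul _).congr_deriv ?_
  rw [expSum_eq_neg_one_pow_mul h0, ← mul_assoc, ← pow_add]
  have : (-1 : ℝ) ^ (n + (n + 1)) = -1 := Odd.neg_one_pow ⟨n, by ring⟩
  rw [this, neg_one_mul]

theorem absExpSum_le (hl : ExpSummable l) (h0 : ∀ i, 0 ≤ l i) (n : ℕ) {t : ℝ} (ht : 0 < t) :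
    absExpSum l n t ≤ n.factorial * (2 / t) ^ n * absExpSum l 0 (t / 2) := by
  rw [absExpSum, absExpSum, ← tsum_mul_left]
  refine (hl.summable_abs n ht).tsum_le_tsum (fun i => ?_)
    ((hl.summable_abs 0 (half_pos ht)).mul_left _)
  rw [abs_of_nonneg (h0 i), pow_zero, one_mul]
  exact pow_mul_exp_neg_le (h0 i) ht n

/-- For infinitely many exponents the sums blow up at `0`: arbitrarily many exponents are at
least `1`. -/
theorem tendsto_absExpSum_atTop [Infinite ι] (hl : ExpSummable l) (n : ℕ) :
    Tendsto (absExpSum l n) (𝓝[>] 0) atTop := by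
  rw [tendsto_atTop]
  intro M
  obtain ⟨N, hN⟩ := exists_nat_gt M
  obtain ⟨s, hs, hcard⟩ := (hl.finite_le 1).infinite_compl.exists_subset_card_eq N
  have hlim : Tendsto (fun t => ∑ i ∈ s, |l i| ^ n * Real.exp (-(l i * t))) (𝓝[>] 0)
      (𝓝 (∑ i ∈ s, |l i| ^ n)) := by
    have hc : Continuous fun t => ∑ i ∈ s, |l i| ^ n * Real.exp (-(l i * t)) := by fun_prop
    simpa using (hc.tendsto 0).mono_left (nhdsWithin_le_nhds (s := Ioi 0))
  have hM : M < ∑ i ∈ s, |l i| ^ n := by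
    refine hN.trans_le ?_
    calc (N : ℝ) = ∑ i ∈ s, (1 : ℝ) := by simp [hcard]
      _ ≤ _ := Finset.sum_le_sum fun i hi => by
        have h1 : 1 < l i := by simpa using hs hi
        exact one_le_pow₀ (h1.le.trans (le_abs_self _))
  filter_upwards [hlim.eventually_const_lt hM, self_mem_nhdsWithin] with t h1 h2
  exact h1.le.trans ((hl.summable_abs n h2).sum_le_tsum s fun i _ => by positivity)

end Nonneg

end ExpSum

/-! ### Smoothly varying functions -/

section SmoothlyVarying

/-- `SlowTo k c Q`: the function `Q` tends to `c` at infinity, is eventually `k` times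
differentiable, and its derivatives of orders `1, …, k` tend to `0`. -/
def SlowTo : ℕ → ℝ → (ℝ → ℝ) → Prop
  | 0, c, Q => Tendsto Q atTop (𝓝 c)
  | k + 1, c, Q => Tendsto Q atTop (𝓝 c) ∧ (∀ᶠ x in atTop, DifferentiableAt ℝ Q x) ∧
      SlowTo k 0 (deriv Q)

theorem eventually_nhds_of_eventually_atTop {P : ℝ → Prop} (h : ∀ᶠ x in atTop, P x) :
    ∀ᶠ x in atTop, ∀ᶠ y in 𝓝 x, P y := by
  obtain ⟨b, hb⟩ := eventually_atTop.mp h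
  filter_upwards [eventually_gt_atTop b] with x hx
  filter_upwards [Ioi_mem_nhds hx] with y hy using hb y hy.le

namespace SlowTo

theorem tendsto {k : ℕ} {c : ℝ} {Q : ℝ → ℝ} (h : SlowTo k c Q) : Tendsto Q atTop (𝓝 c) := by
  cases k with
  | zero => exact h
  | succ k => exact h.1

theorem congr {k : ℕ} {c : ℝ} {Q R : ℝ → ℝ} (h : SlowTo k c Q) (hQR : Q =ᶠ[atTop] R) :
    SlowTo k c R := by
  induction k generalizing c Q R with
  | zero => exact Tendsto.congr' hQR h
  | succ k ih =>
    have hloc : ∀ᶠ x in atTop, Q =ᶠ[𝓝 x] R := eventually_nhds_of_eventually_atTop hQR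
    refine ⟨h.1.congr' hQR, ?_, ih h.2.2 ?_⟩
    · filter_upwards [h.2.1, hloc] with x hx hx' using hx'.differentiableAt_iff.mp hx
    · filter_upwards [hloc] with x hx using hx.deriv_eq

theorem of_succ {k : ℕ} {c : ℝ} {Q : ℝ → ℝ} (h : SlowTo (k + 1) c Q) : SlowTo k c Q := by
  induction k generalizing c Q with
  | zero => exact h.1
  | succ k ih => exact ⟨h.1, h.2.1, ih h.2.2⟩

theorem const (k : ℕ) (c : ℝ) : SlowTo k c fun _ => c := by
  induction k generalizing c with
  | zero => exact tendsto_const_nhds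
  | succ k ih =>
    refine ⟨tendsto_const_nhds, Eventually.of_forall fun x => differentiableAt_const c, ?_⟩
    rw [deriv_const']
    exact ih 0

theorem add {k : ℕ} {c d : ℝ} {Q R : ℝ → ℝ} (hQ : SlowTo k c Q) (hR : SlowTo k d R) :
    SlowTo k (c + d) fun x => Q x + R x := by
  induction k generalizing c d Q R with
  | zero => exact Tendsto.add hQ hR
  | succ k ih =>
    refine ⟨hQ.1.add hR.1, ?_, ?_⟩
    · filter_upwards [hQ.2.1, hR.2.1] with x h1 h2 using h1.add h2
    · have h := ih hQ.2.2 hR.2.2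
      rw [add_zero] at h
      refine h.congr ?_
      filter_upwards [hQ.2.1, hR.2.1] with x h1 h2 using (deriv_fun_add h1 h2).symm

theorem mul {k : ℕ} {c d : ℝ} {Q R : ℝ → ℝ} (hQ : SlowTo k c Q) (hR : SlowTo k d R) :
    SlowTo k (c * d) fun x => Q x * R x := by
  induction k generalizing c d Q R with
  | zero => exact Tendsto.mul hQ hR
  | succ k ih =>
    refine ⟨hQ.1.mul hR.1, ?_, ?_⟩
    · filter_upwards [hQ.2.1, hR.2.1] with x h1 h2 using h1.mul h2
    · have h := (ih hQ.2.2 hR.of_succ).add (ih hQ.of_succ hR.2.2)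
      rw [zero_mul, mul_zero, add_zero] at h
      refine h.congr ?_
      filter_upwards [hQ.2.1, hR.2.1] with x h1 h2 using (deriv_fun_mul h1 h2).symm

theorem of_iteratedDeriv {h : ℝ → ℝ} {b : ℝ} (hh : ContDiffOn ℝ ∞ h (Ioi b)) (k : ℕ) {m : ℕ}
    {c : ℝ} (hm : Tendsto (iteratedDeriv m h) atTop (𝓝 c))
    (hlim : ∀ n, m < n → Tendsto (iteratedDeriv n h) atTop (𝓝 0)) :
    SlowTo k c (iteratedDeriv m h) := by
  induction k generalizing m c with
  | zero => exact hm
  | succ k ih =>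
    refine ⟨hm, ?_, ?_⟩
    · filter_upwards [eventually_gt_atTop b] with x hx
      have h1 : DifferentiableAt ℝ (iteratedDerivWithin m h (Ioi b)) x :=
        (hh.differentiableOn_iteratedDerivWithin (by exact_mod_cast WithTop.coe_lt_top _)
          isOpen_Ioi.uniqueDiffOn).differentiableAt (Ioi_mem_nhds hx)
      refine h1.congr_of_eventuallyEq ?_
      filter_upwards [Ioi_mem_nhds hx] with y hy
      exact (iteratedDerivWithin_of_isOpen isOpen_Ioi hy).symm
    · rw [← iteratedDeriv_succ]
      exact ih (hlim _ (Nat.lt_succ_self m)) fun n hn => hlim n (by omega)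

end SlowTo

/-- The factors in `(d / dt) ^ n exp (h (-log t)) = t ^ (-n) * exp (h (-log t)) * Q n (-log t)`. -/
noncomputable def derivFactor (h : ℝ → ℝ) : ℕ → ℝ → ℝ
  | 0 => fun _ => 1
  | n + 1 => fun x => -1 * (deriv (derivFactor h n) x + (deriv h x + n) * derivFactor h n x)

/-- The rising factorial `p (p + 1) ⋯ (p + n - 1)`. -/
noncomputable def risingFactorial (p : ℝ) (n : ℕ) : ℝ := ∏ j ∈ Finset.range n, (p + j)

theorem risingFactorial_pos {p : ℝ} (hp : 0 < p) (n : ℕ) : 0 < risingFactorial p n :=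
  Finset.prod_pos fun _ _ => by positivity

theorem slowTo_derivFactor {h : ℝ → ℝ} {p : ℝ} (hh : ∀ k, SlowTo k p (deriv h)) (n k : ℕ) :
    SlowTo k ((-1) ^ n * risingFactorial p n) (derivFactor h n) := by
  induction n generalizing k with
  | zero => simpa [risingFactorial, derivFactor] using SlowTo.const k 1
  | succ n ih =>
    have h1 := (SlowTo.const k (-1)).mul
      ((ih (k + 1)).2.2.add (((hh k).add (SlowTo.const k (n : ℝ))).mul (ih k)))
    have h2 : (-1) ^ (n + 1) * risingFactorial p (n + 1) =
        -1 * (0 + (p + n) * ((-1) ^ n * risingFactorial p n)) := by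
      rw [risingFactorial, Finset.prod_range_succ, ← risingFactorial]
      ring
    rw [h2]
    exact h1

theorem tendsto_neg_log : Tendsto (fun t => -Real.log t) (𝓝[>] 0) atTop :=
  tendsto_neg_atBot_atTop.comp Real.tendsto_log_nhdsGT_zero

/-- The formula that defines `derivFactor`, for a function that is `exp (h (-log t))` near `0`. -/
theorem eventually_iteratedDeriv_eq {h g : ℝ → ℝ} {p : ℝ} (hh : ∀ k, SlowTo k p (deriv h))
    (hd : ∀ᶠ x in atTop, DifferentiableAt ℝ h x)
    (hg : ∀ᶠ t in 𝓝[>] 0, g t = Real.exp (h (-Real.log t))) (n : ℕ) :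
    ∀ᶠ t in 𝓝[>] 0, iteratedDeriv n g t =
      t⁻¹ ^ n * Real.exp (h (-Real.log t)) * derivFactor h n (-Real.log t) := by
  induction n with
  | zero => simpa [derivFactor] using hg
  | succ n ih =>
    filter_upwards [eventually_eventually_nhdsWithin.mpr ih, tendsto_neg_log.eventually hd,
      tendsto_neg_log.eventually (slowTo_derivFactor hh n 1).2.1, self_mem_nhdsWithin]
      with t h1 h2 h3 ht
    have ht0 : t ≠ 0 := ne_of_gt ht
    rw [isOpen_Ioi.nhdsWithin_eq ht] at h1
    have hlog := (Real.hasDerivAt_log ht0).fun_neg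
    have hder := (((hasDerivAt_inv ht0).fun_pow n).fun_mul
      (h2.hasDerivAt.comp t hlog).exp).fun_mul (h3.hasDerivAt.comp t hlog)
    rw [iteratedDeriv_succ, EventuallyEq.deriv_eq h1]
    refine HasDerivAt.deriv (hder.congr_deriv ?_)
    rw [derivFactor, ← inv_pow]
    simp only [Function.comp_apply]
    generalize t⁻¹ = y
    rcases n with _ | n
    · simp
      ring
    · simp only [Nat.add_sub_cancel]
      push_cast
      ring

section Growth

variable {h : ℝ → ℝ} {p : ℝ}

/-- If `h' → p`, then `h x - p x` is eventually Lipschitz with any given constant. -/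
theorem exists_abs_sub_le_of_tendsto_deriv (hh : Tendsto (deriv h) atTop (𝓝 p))
    (hd : ∀ᶠ x in atTop, DifferentiableAt ℝ h x) {ε : ℝ} (hε : 0 < ε) :
    ∃ b, ∀ x y, b < x → b < y → |(h y - h x) - p * (y - x)| ≤ ε * |y - x| := by
  obtain ⟨b, hb⟩ := eventually_atTop.mp (hd.and (Metric.tendsto_nhds.mp hh ε hε))
  refine ⟨b, fun x y hx hy => ?_⟩
  have hder (z : ℝ) (hz : z ∈ Ioi b) :
      HasDerivAt (fun z => h z - p * z) (deriv h z - p) z := by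
    simpa using (hb z (le_of_lt hz)).1.hasDerivAt.fun_sub ((hasDerivAt_id z).const_mul p)
  have := Convex.norm_image_sub_le_of_norm_hasDerivWithin_le (f := fun z => h z - p * z) (C := ε)
    (fun z hz => (hder z hz).hasDerivWithinAt)
    (fun z hz => by simpa [Real.dist_eq] using (hb z (le_of_lt hz)).2.le) (convex_Ioi b)
    (mem_Ioi.mpr hx) (mem_Ioi.mpr hy)
  rw [Real.norm_eq_abs, Real.norm_eq_abs] at this
  convert this using 2
  ring

theorem tendsto_sub_of_tendsto_deriv (hh : Tendsto (deriv h) atTop (𝓝 p))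
    (hd : ∀ᶠ x in atTop, DifferentiableAt ℝ h x) (c : ℝ) :
    Tendsto (fun x => h (x + c) - h x) atTop (𝓝 (p * c)) := by
  rw [Metric.tendsto_nhds]
  intro ε hε
  obtain ⟨b, hb⟩ := exists_abs_sub_le_of_tendsto_deriv hh hd
    (show 0 < ε / (|c| + 1) by positivity)
  filter_upwards [eventually_gt_atTop b, eventually_gt_atTop (b - c)] with x h1 h2
  have := hb x (x + c) h1 (by linarith)
  rw [add_sub_cancel_left] at this
  rw [Real.dist_eq]
  refine this.trans_lt ?_
  rw [div_mul_eq_mul_div, div_lt_iff₀ (by positivity)]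
  nlinarith [abs_nonneg c]

theorem tendsto_atTop_of_tendsto_deriv (hp : 0 < p) (hh : Tendsto (deriv h) atTop (𝓝 p))
    (hd : ∀ᶠ x in atTop, DifferentiableAt ℝ h x) : Tendsto h atTop atTop := by
  obtain ⟨b, hb⟩ := exists_abs_sub_le_of_tendsto_deriv hh hd (half_pos hp)
  have hlin : Tendsto (fun x => h (b + 1) + p / 2 * (x - (b + 1))) atTop atTop :=
    tendsto_atTop_add_const_left _ _ ((tendsto_atTop_add_const_right _ _ tendsto_id).const_mul_atTop
      (half_pos hp))
  refine tendsto_atTop_mono' _ ?_ hlin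
  filter_upwards [eventually_gt_atTop (b + 1)] with x hx
  have h1 := hb (b + 1) x (by linarith) (by linarith)
  rw [abs_of_pos (show 0 < x - (b + 1) by linarith)] at h1
  have h2 := (abs_le.mp h1).1
  linarith

end Growth

/-- The properties of `g t = f (1 / t)`, near `t = 0`, for a function `f` that varies smoothly at
infinity with index `p`: regular variation with index `-p`, blow-up at `0`, and the asymptotics of
all derivatives. -/
structure SmoothlyVaryingAtZero (p : ℝ) (g : ℝ → ℝ) : Prop where
  pos : ∀ᶠ t in 𝓝[>] 0, 0 < g t
  tendsto_ratio : ∀ κ, 0 < κ → Tendsto (fun t => g (κ * t) / g t) (𝓝[>] 0) (𝓝 (κ ^ (-p)))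
  tendsto_atTop : Tendsto g (𝓝[>] 0) atTop
  tendsto_iteratedDeriv : ∀ n, Tendsto (fun t => iteratedDeriv n g t / (t⁻¹ ^ n * g t)) (𝓝[>] 0)
    (𝓝 ((-1) ^ n * risingFactorial p n))

theorem tendsto_mul_nhdsGT_zero {κ : ℝ} (hκ : 0 < κ) :
    Tendsto (fun t => κ * t) (𝓝[>] 0) (𝓝[>] 0) := by
  refine tendsto_nhdsWithin_iff.mpr ⟨?_, ?_⟩
  · have hc : Continuous fun t : ℝ => κ * t := by fun_prop
    simpa using (hc.tendsto 0).mono_left (nhdsWithin_le_nhds (s := Ioi 0))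
  · filter_upwards [self_mem_nhdsWithin] with t ht using mul_pos hκ ht

theorem SmoothlyVarying.atZero {p : ℝ} (hp : 0 < p) {f : ℝ → ℝ} (hf : SmoothlyVarying p f) :
    SmoothlyVaryingAtZero p fun t => f t⁻¹ := by
  obtain ⟨a, ha, hpos, hsm, h1, h2⟩ := hf
  set h : ℝ → ℝ := fun x => Real.log (f (Real.exp x)) with hh
  have hexp (x : ℝ) (hx : x ∈ Ioi (Real.log a)) : a < Real.exp x :=
    (Real.log_lt_iff_lt_exp ha).mp hx
  have hcd : ContDiffOn ℝ ∞ h (Ioi (Real.log a)) := by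
    refine ContDiffOn.log (hsm.comp Real.contDiff_exp.contDiffOn fun x hx => (hexp x hx).le) ?_
    exact fun x hx => (hpos _ (hexp x hx).le).ne'
  have hslow (k : ℕ) : SlowTo k p (deriv h) := by
    have := SlowTo.of_iteratedDeriv hcd k h1 fun n hn => h2 n hn
    rwa [iteratedDeriv_one] at this
  have hd : ∀ᶠ x in atTop, DifferentiableAt ℝ h x := by
    filter_upwards [eventually_gt_atTop (Real.log a)] with x hx
    exact (hcd.contDiffAt (Ioi_mem_nhds hx)).differentiableAt (by simp)
  have hlim := (hslow 0).tendsto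
  have hpos' : ∀ᶠ t in 𝓝[>] (0 : ℝ), 0 < f t⁻¹ := by
    filter_upwards [tendsto_inv_nhdsGT_zero.eventually (eventually_ge_atTop a)] with t ht
    exact hpos _ ht
  have hg : ∀ᶠ t in 𝓝[>] (0 : ℝ), f t⁻¹ = Real.exp (h (-Real.log t)) := by
    filter_upwards [hpos', self_mem_nhdsWithin] with t ht ht0
    simp only [hh]
    rw [Real.exp_neg, Real.exp_log ht0, Real.exp_log ht]
  refine ⟨hpos', fun κ hκ => ?_, ?_, fun n => ?_⟩
  · have := (Real.continuous_exp.tendsto _).comp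
      ((tendsto_sub_of_tendsto_deriv hlim hd (-Real.log κ)).comp tendsto_neg_log)
    rw [Real.rpow_def_of_pos hκ, show Real.log κ * -p = p * -Real.log κ by ring]
    refine this.congr' ?_
    filter_upwards [hg, (tendsto_mul_nhdsGT_zero hκ).eventually hg, self_mem_nhdsWithin]
      with t h3 h4 ht
    rw [h3, h4, ← Real.exp_sub, Real.log_mul hκ.ne' (ne_of_gt ht), Function.comp_apply,
      Function.comp_apply]
    congr 3
    ring
  · refine (Real.tendsto_exp_atTop.comp
      ((tendsto_atTop_of_tendsto_deriv hp hlim hd).comp tendsto_neg_log)).congr' ?_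
    filter_upwards [hg] with t ht using ht.symm
  · refine ((slowTo_derivFactor hslow n 0).tendsto.comp tendsto_neg_log).congr' ?_
    filter_upwards [hg, eventually_iteratedDeriv_eq hslow hd hg n, self_mem_nhdsWithin]
      with t h3 h4 ht
    have ht0 : (t : ℝ) ≠ 0 := ne_of_gt ht
    rw [h4, h3]
    have := Real.exp_pos (h (-Real.log t))
    simp only [Function.comp_apply]
    field_simp

end SmoothlyVarying

/-! ### A monotone density theorem -/

section Tauberian

/-- The monotone density theorem at `0`: if `-G' = D` is nonincreasing and `G` is asymptotic to
`c r` with `r` regularly varying of index `-q`, then `t D t` is asymptotic to `c q r`.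
The mean value theorem compares `t D t` with `(G t - G (κ t)) / (κ - 1)`, and `κ → 1`. -/
theorem tendsto_mul_div_of_antitoneOn {G D r : ℝ → ℝ} {c q : ℝ}
    (hG : ∀ t, 0 < t → HasDerivAt G (-D t) t) (hD : AntitoneOn D (Ioi 0))
    (hr : ∀ᶠ t in 𝓝[>] 0, 0 < r t)
    (hrr : ∀ κ, 0 < κ → Tendsto (fun t => r (κ * t) / r t) (𝓝[>] 0) (𝓝 (κ ^ (-q))))
    (hlim : Tendsto (fun t => G t / r t) (𝓝[>] 0) (𝓝 c)) :
    Tendsto (fun t => t * D t / r t) (𝓝[>] 0) (𝓝 (c * q)) := by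
  have hψ (κ : ℝ) (hκ : 0 < κ) : Tendsto (fun t => (G t - G (κ * t)) / (κ - 1) / r t) (𝓝[>] 0)
      (𝓝 (-c * ((κ - 1)⁻¹ * (κ ^ (-q) - 1)))) := by
    have h1 := ((hlim.comp (tendsto_mul_nhdsGT_zero hκ)).mul (hrr κ hκ))
    have h2 := (hlim.sub h1).mul_const (κ - 1)⁻¹
    have h3 : -c * ((κ - 1)⁻¹ * (κ ^ (-q) - 1)) = (c - c * κ ^ (-q)) * (κ - 1)⁻¹ := by ring
    rw [h3]
    refine h2.congr' ?_
    filter_upwards [hr, (tendsto_mul_nhdsGT_zero hκ).eventually hr] with t h4 h5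
    simp only [Function.comp_apply]
    field_simp
  have hφ : Tendsto (fun κ : ℝ => -c * ((κ - 1)⁻¹ * (κ ^ (-q) - 1))) (𝓝[≠] 1) (𝓝 (c * q)) := by
    have h1 : HasDerivAt (fun κ : ℝ => κ ^ (-q)) (-q) 1 := by
      simpa using Real.hasDerivAt_rpow_const (x := 1) (p := -q) (Or.inl one_ne_zero)
    have h2 := (hasDerivAt_iff_tendsto_slope.mp h1).const_mul (-c)
    rw [neg_mul_neg] at h2
    refine h2.congr fun κ => ?_
    simp [slope_def_field, div_eq_inv_mul]
  have hmvt {s t : ℝ} (hs : 0 < s) (hst : s < t) :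
      (t - s) * D t ≤ G s - G t ∧ G s - G t ≤ (t - s) * D s := by
    obtain ⟨ξ, hξ, h⟩ := exists_hasDerivAt_eq_slope G (fun t => -D t) hst
      (fun x hx => (hG x (hs.trans_le hx.1)).continuousAt.continuousWithinAt)
      fun x hx => hG x (hs.trans hx.1)
    have hts : 0 < t - s := sub_pos.mpr hst
    have h' : G s - G t = (t - s) * D ξ := by
      rw [eq_div_iff hts.ne'] at h
      linear_combination h
    have hξ0 : 0 < ξ := hs.trans hξ.1
    rw [h']
    exact ⟨mul_le_mul_of_nonneg_left (hD hξ0 (hs.trans hst) hξ.2.le) hts.le,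
      mul_le_mul_of_nonneg_left (hD hs hξ0 hξ.1.le) hts.le⟩
  refine tendsto_order.mpr ⟨fun a ha => ?_, fun a ha => ?_⟩
  · obtain ⟨κ, hκ, hκ1 : 1 < κ⟩ := (((hφ.mono_left (nhdsGT_le_nhdsNE 1)).eventually
      (eventually_gt_nhds ha)).and self_mem_nhdsWithin).exists
    have hκ0 : 0 < κ := by linarith
    filter_upwards [(hψ κ hκ0).eventually_const_lt hκ, hr, self_mem_nhdsWithin] with t h1 h2 ht
    have ht : 0 < t := ht
    refine h1.trans_le ?_
    gcongr
    rw [div_le_iff₀ (by linarith)]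
    have := (hmvt ht (show t < κ * t by nlinarith)).2
    linarith
  · obtain ⟨κ, ⟨hκ, hκ1 : κ < 1⟩, hκ0 : 0 < κ⟩ := ((((hφ.mono_left (nhdsLT_le_nhdsNE 1)).eventually
      (eventually_lt_nhds ha)).and self_mem_nhdsWithin).and
      (nhdsWithin_le_nhds (Ioi_mem_nhds one_pos))).exists
    filter_upwards [(hψ κ hκ0).eventually_lt_const hκ, hr, self_mem_nhdsWithin] with t h1 h2 ht
    have ht : 0 < t := ht
    refine lt_of_le_of_lt ?_ h1
    gcongr
    rw [le_div_iff_of_neg (by linarith)]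
    have := (hmvt (mul_pos hκ0 ht) (show κ * t < t by nlinarith)).1
    linarith

end Tauberian

/-! ### Asymptotics of the derivatives of exponential sums -/

section Asymptotics

open Asymptotics

theorem Equivalent.congr {u : Filter ℝ} {f f' g : ℝ → ℝ} (h : Equivalent u f g)
    (hf : f =ᶠ[u] f') : Equivalent u f' g :=
  Tendsto.congr' (by filter_upwards [hf] with t ht; rw [ht]) h

theorem BigO.isBigO {u : Filter ℝ} {f g : ℝ → ℝ} (h : BigO u f g) : f =O[u] g :=
  (isBigO_iff_div_isBoundedUnder (h.1.mono fun _ h0 h1 => absurd h1 h0)).mpr h.2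

theorem bigO_of_isBigO {u : Filter ℝ} {f g : ℝ → ℝ} (h0 : ∀ᶠ t in u, g t ≠ 0) (h : f =O[u] g) :
    BigO u f g :=
  ⟨h0, (isBigO_iff_div_isBoundedUnder (h0.mono fun _ h0 h1 => absurd h1 h0)).mp h⟩

theorem BigO.congr {u : Filter ℝ} {f f' g : ℝ → ℝ} (h : BigO u f g) (hf : f =ᶠ[u] f') :
    BigO u f' g :=
  bigO_of_isBigO h.1 (h.isBigO.congr' hf .rfl)

theorem equivalent_of_tendsto_div {u : Filter ℝ} {f g w : ℝ → ℝ} {c d : ℝ} (hd : d ≠ 0)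
    (hcd : |c| = |d|) (hw : ∀ᶠ t in u, w t ≠ 0) (hf : Tendsto (fun t => f t / w t) u (𝓝 c))
    (hg : Tendsto (fun t => g t / w t) u (𝓝 d)) : Equivalent u f g := by
  have h := (hf.div hg hd).abs
  rw [abs_div, hcd, div_self (abs_ne_zero.mpr hd)] at h
  refine h.congr' ?_
  filter_upwards [hw] with t ht
  rw [Pi.div_apply, div_div_div_cancel_right₀ ht]

theorem isBigO_one_isLittleO_atTop {u : Filter ℝ} {w : ℝ → ℝ} (hw : Tendsto w u atTop) :
    (fun _ => (1 : ℝ)) =o[u] w :=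
  (isLittleO_const_left_of_ne one_ne_zero).mpr (tendsto_norm_atTop_atTop.comp hw)

theorem tendsto_div_of_sub_isBigO_one {u : Filter ℝ} {f g w : ℝ → ℝ} {c : ℝ}
    (hw : Tendsto w u atTop) (hfg : (fun t => f t - g t) =O[u] (fun _ => (1 : ℝ)))
    (hg : Tendsto (fun t => g t / w t) u (𝓝 c)) : Tendsto (fun t => f t / w t) u (𝓝 c) := by
  have h := (hfg.trans_isLittleO (isBigO_one_isLittleO_atTop hw)).tendsto_div_nhds_zero.add hg
  rw [zero_add] at h
  refine h.congr fun t => ?_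
  rw [← add_div, sub_add_cancel]

variable {ι : Type*} {l : ι → ℝ}

/-- The nonpositive exponents, finitely many, contribute a bounded amount to both sums, while the
sums over the other exponents agree up to sign and blow up. -/
theorem ExpSummable.equivalent_absExpSum [Infinite ι] (hl : ExpSummable l) (n : ℕ) :
    Equivalent (𝓝[>] 0) (expSum l n) (absExpSum l n) := by
  have h0 : ∀ i, 0 ≤ max (l i) 0 := fun i => le_max_right _ _
  have hw := tendsto_absExpSum_atTop hl.posPart n
  have hne := hw.eventually_ne_atTop 0
  have h1 : Tendsto (fun t => absExpSum (fun i => max (l i) 0) n t /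
      absExpSum (fun i => max (l i) 0) n t) (𝓝[>] 0) (𝓝 1) :=
    tendsto_const_nhds.congr' (by filter_upwards [hne] with t ht; rw [div_self ht])
  refine equivalent_of_tendsto_div (c := (-1) ^ n) one_ne_zero (by simp) hne
    (tendsto_div_of_sub_isBigO_one hw (hl.expSum_sub_isBigO_one n) ?_)
    (tendsto_div_of_sub_isBigO_one hw (hl.absExpSum_sub_isBigO_one n) h1)
  have := h1.const_mul ((-1) ^ n)
  rw [mul_one] at this
  refine this.congr fun t => ?_
  rw [expSum_eq_neg_one_pow_mul h0, mul_div_assoc]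

variable {p : ℝ} {g : ℝ → ℝ}

namespace SmoothlyVaryingAtZero

theorem tendsto_inv_pow_mul_atTop (hg : SmoothlyVaryingAtZero p g) (n : ℕ) :
    Tendsto (fun t => t⁻¹ ^ n * g t) (𝓝[>] 0) atTop := by
  refine tendsto_atTop_mono' _ ?_ hg.tendsto_atTop
  filter_upwards [hg.pos, tendsto_inv_nhdsGT_zero.eventually (eventually_ge_atTop 1)] with t h1 h2
  exact le_mul_of_one_le_left h1.le (one_le_pow₀ h2)

theorem tendsto_ratio_inv_pow_mul (hg : SmoothlyVaryingAtZero p g) (n : ℕ) {κ : ℝ} (hκ : 0 < κ) :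
    Tendsto (fun t => (κ * t)⁻¹ ^ n * g (κ * t) / (t⁻¹ ^ n * g t)) (𝓝[>] 0)
      (𝓝 (κ ^ (-(p + n)))) := by
  have h := (hg.tendsto_ratio κ hκ).const_mul (κ⁻¹ ^ n)
  have h1 : κ ^ (-(p + n)) = κ⁻¹ ^ n * κ ^ (-p) := by
    rw [neg_add, Real.rpow_add hκ, Real.rpow_neg hκ.le (n : ℝ), Real.rpow_natCast, inv_pow,
      mul_comm]
  rw [h1]
  refine h.congr' ?_
  filter_upwards [self_mem_nhdsWithin] with t ht
  have ht : t⁻¹ ^ n ≠ 0 := pow_ne_zero _ (inv_ne_zero (ne_of_gt ht))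
  rw [mul_inv, mul_pow, mul_right_comm, mul_comm _ (t⁻¹ ^ n), mul_div_mul_left _ _ ht,
    mul_div_assoc]

theorem inv_pow_mul_isBigO (hp : 0 < p) (hg : SmoothlyVaryingAtZero p g) (n : ℕ) :
    (∀ᶠ t in 𝓝[>] 0, iteratedDeriv n g t ≠ 0) ∧
      (fun t => t⁻¹ ^ n * g t) =O[𝓝[>] 0] iteratedDeriv n g := by
  have hc : (-1) ^ n * risingFactorial p n ≠ 0 :=
    mul_ne_zero (by simp) (risingFactorial_pos hp n).ne'
  have h0 : ∀ᶠ t in 𝓝[>] 0, iteratedDeriv n g t ≠ 0 := by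
    filter_upwards [(hg.tendsto_iteratedDeriv n).eventually_ne hc] with t ht h0
    rw [h0, zero_div] at ht
    exact ht rfl
  refine ⟨h0, isBigO_of_div_tendsto_nhds (h0.mono fun _ h1 h2 => absurd h2 h1)
    ((-1) ^ n * risingFactorial p n)⁻¹ ?_⟩
  refine ((hg.tendsto_iteratedDeriv n).inv₀ hc).congr fun t => ?_
  rw [Pi.div_apply, inv_div]

end SmoothlyVaryingAtZero

/-- An upper bound by `g` passes to the derivatives, because `x ^ n * exp (-x t)` is at most a
multiple of `t ^ (-n) * exp (-x t / 2)`. -/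
theorem ExpSummable.bigO_iteratedDeriv (hp : 0 < p) (hg : SmoothlyVaryingAtZero p g)
    (hl : ExpSummable l) (h : BigO (𝓝[>] 0) (expSum l 0) g) (n : ℕ) :
    BigO (𝓝[>] 0) (expSum l n) (iteratedDeriv n g) := by
  have h0 : ∀ i, 0 ≤ max (l i) 0 := fun i => le_max_right _ _
  set P : ℕ → ℝ → ℝ := absExpSum fun i => max (l i) 0 with hP
  obtain ⟨hne, hr⟩ := hg.inv_pow_mul_isBigO hp n
  refine bigO_of_isBigO hne (IsBigO.trans ?_ hr)
  have h1 : P 0 =O[𝓝[>] 0] g := by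
    have h2 := h.isBigO.sub ((hl.expSum_sub_isBigO_one 0).trans
      (isBigO_one_isLittleO_atTop hg.tendsto_atTop).isBigO)
    refine h2.congr_left fun t => ?_
    rw [sub_sub_cancel, expSum_eq_neg_one_pow_mul h0, pow_zero, one_mul]
  have hhalf : (fun t => g (2⁻¹ * t)) =O[𝓝[>] 0] g :=
    isBigO_of_div_tendsto_nhds (hg.pos.mono fun _ h1 h2 => absurd h2 h1.ne') _
      (hg.tendsto_ratio 2⁻¹ (by norm_num))
  have h2 : (fun t => P 0 (2⁻¹ * t)) =O[𝓝[>] 0] g :=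
    (h1.comp_tendsto (tendsto_mul_nhdsGT_zero (by norm_num : (0 : ℝ) < 2⁻¹))).trans hhalf
  have h3 : P n =O[𝓝[>] 0] fun t => t⁻¹ ^ n * P 0 (2⁻¹ * t) := by
    refine IsBigO.of_bound (n.factorial * 2 ^ n) ?_
    filter_upwards [self_mem_nhdsWithin] with t ht
    have ht : 0 < t := ht
    have h4 := absExpSum_le hl.posPart h0 n ht
    rw [Real.norm_of_nonneg (absExpSum_nonneg _ _ _),
      Real.norm_of_nonneg (mul_nonneg (by positivity) (absExpSum_nonneg _ _ _))]
    refine h4.trans (le_of_eq ?_)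
    rw [div_eq_mul_inv 2 t, mul_pow, div_eq_inv_mul]
    ring
  have h4 : P n =O[𝓝[>] 0] fun t => t⁻¹ ^ n * g t := h3.trans ((isBigO_refl _ _).mul h2)
  have h5 := ((hl.expSum_sub_isBigO_one n).trans
    (isBigO_one_isLittleO_atTop (hg.tendsto_inv_pow_mul_atTop n)).isBigO).add
    (h4.const_mul_left ((-1) ^ n))
  refine h5.congr_left fun t => ?_
  rw [expSum_eq_neg_one_pow_mul h0, sub_add_cancel]

/-- Asymptotic equivalence passes to the derivatives, by induction with the monotone density theorem
for the sums over the positive parts of the exponents. -/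
theorem ExpSummable.equivalent_iteratedDeriv (hp : 0 < p) (hg : SmoothlyVaryingAtZero p g)
    (hl : ExpSummable l) (h : Equivalent (𝓝[>] 0) (expSum l 0) g) (n : ℕ) :
    Equivalent (𝓝[>] 0) (expSum l n) (iteratedDeriv n g) := by
  have h0 : ∀ i, 0 ≤ max (l i) 0 := fun i => le_max_right _ _
  set P : ℕ → ℝ → ℝ := absExpSum fun i => max (l i) 0 with hP
  have h1 : Tendsto (fun t => expSum l 0 t / g t) (𝓝[>] 0) (𝓝 1) := by
    refine Tendsto.congr' ?_ h
    filter_upwards [hg.pos] with t ht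
    have : 0 ≤ expSum l 0 t := tsum_nonneg fun i => by positivity
    exact abs_of_nonneg (by positivity)
  have h2 : Tendsto (fun t => P 0 t / g t) (𝓝[>] 0) (𝓝 1) := by
    refine tendsto_div_of_sub_isBigO_one hg.tendsto_atTop ?_ h1
    refine (hl.expSum_sub_isBigO_one 0).neg_left.congr_left fun t => ?_
    rw [neg_sub, expSum_eq_neg_one_pow_mul h0, pow_zero, one_mul]
  have h3 (n : ℕ) : Tendsto (fun t => P n t / (t⁻¹ ^ n * g t)) (𝓝[>] 0)
      (𝓝 (risingFactorial p n)) := by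
    induction n with
    | zero => simpa [risingFactorial] using h2
    | succ n ih =>
      have h4 := tendsto_mul_div_of_antitoneOn (fun t => hasDerivAt_absExpSum hl.posPart h0 n)
        (absExpSum_antitoneOn hl.posPart h0 (n + 1))
        ((hg.tendsto_inv_pow_mul_atTop n).eventually_gt_atTop 0)
        (fun κ hκ => hg.tendsto_ratio_inv_pow_mul n hκ) ih
      rw [risingFactorial, Finset.prod_range_succ]
      refine h4.congr' ?_
      filter_upwards [self_mem_nhdsWithin] with t ht
      have ht : t ≠ 0 := ne_of_gt ht
      rw [pow_succ]
      field_simp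
      rfl
  have hw := hg.tendsto_inv_pow_mul_atTop n
  refine equivalent_of_tendsto_div (mul_ne_zero (by simp) (risingFactorial_pos hp n).ne') rfl
    (hw.eventually_ne_atTop 0) (tendsto_div_of_sub_isBigO_one hw (hl.expSum_sub_isBigO_one n) ?_)
    (hg.tendsto_iteratedDeriv n)
  refine ((h3 n).const_mul ((-1) ^ n)).congr fun t => ?_
  rw [expSum_eq_neg_one_pow_mul h0, mul_div_assoc]

end Asymptotics

/-! ### Powers of the generator -/

section Generator

variable {H : Type*} [NormedAddCommGroup H] [InnerProductSpace ℂ H]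

theorem mem_graph_generator {U : ℝ → H →L[ℂ] H} {x y : H}
    (h : Tendsto (diffQuot U x) (𝓝[>] 0) (𝓝 y)) : (x, y) ∈ (generator U).graph := by
  have hx : x ∈ (generator U).domain := ⟨y, h⟩
  exact (LinearPMap.mem_graph_iff _).mpr ⟨⟨x, hx⟩, rfl,
    tendsto_nhds_unique (Exists.choose_spec hx) h⟩

theorem abs_one_sub_exp_le (y : ℝ) : |1 - Real.exp y| ≤ |y| * (1 + Real.exp y) := by
  have h1 := Real.add_one_le_exp y
  have h2 := Real.add_one_le_exp (-y)
  have h3 : Real.exp (-y) * Real.exp y = 1 := by rw [← Real.exp_add, neg_add_cancel, Real.exp_zero]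
  have h4 := mul_le_mul_of_nonneg_right h2 (Real.exp_pos y).le
  have h5 := mul_le_mul_of_nonneg_right (le_abs_self y) (Real.exp_pos y).le
  have h6 := mul_nonneg (abs_nonneg y) (Real.exp_pos y).le
  rw [abs_le]
  constructor <;> nlinarith [neg_abs_le y, abs_nonneg y]

theorem abs_inv_mul_one_sub_exp_le {l s : ℝ} (hs : 0 < s) (hs1 : s ≤ 1) :
    |s⁻¹ * (1 - Real.exp (-(l * s)))| ≤ |l| * (2 + Real.exp (-(l * 1))) := by
  have h1 : Real.exp (-(l * s)) ≤ 1 + Real.exp (-(l * 1)) := by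
    rcases le_total 0 l with hl | hl
    · have : Real.exp (-(l * s)) ≤ 1 := Real.exp_le_one_iff.mpr (by nlinarith)
      linarith [Real.exp_pos (-(l * 1))]
    · have : Real.exp (-(l * s)) ≤ Real.exp (-(l * 1)) := Real.exp_le_exp.mpr (by nlinarith)
      linarith
  have h2 := abs_one_sub_exp_le (-(l * s))
  rw [abs_neg, abs_mul, abs_of_pos hs] at h2
  rw [abs_mul, abs_inv, abs_of_pos hs, inv_mul_le_iff₀ hs]
  calc _ ≤ |l| * s * (1 + Real.exp (-(l * s))) := h2
    _ ≤ |l| * s * (1 + (1 + Real.exp (-(l * 1)))) := by gcongr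
    _ = _ := by ring

theorem tendsto_inv_mul_one_sub_exp (l : ℝ) :
    Tendsto (fun s => s⁻¹ * (1 - Real.exp (-(l * s)))) (𝓝[>] 0) (𝓝 l) := by
  have h : HasDerivAt (fun s => 1 - Real.exp (-(l * s))) l 0 := by
    simpa using (((hasDerivAt_id (0 : ℝ)).const_mul l).fun_neg.exp).const_sub 1
  simpa using h.tendsto_slope_zero.mono_left (nhdsGT_le_nhdsNE 0)

variable [CompleteSpace H] {ι : Type*} (b : HilbertBasis ι ℂ H)

theorem tendsto_diagonalOperator {u : Filter ℝ} {k : ℝ → ι → ℝ} {k' bound : ι → ℝ}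
    (hb : Summable bound) (hk : ∀ i, Tendsto (fun s => k s i) u (𝓝 (k' i)))
    (hle : ∀ᶠ s in u, ∀ i, |k s i| ≤ bound i) :
    Tendsto (fun s => diagonalOperator b (k s)) u (𝓝 (diagonalOperator b k')) := by
  refine tendsto_tsum_of_dominated_convergence hb (fun i => ?_) ?_
  · exact ((Complex.continuous_ofReal.tendsto _).comp (hk i)).smul_const _
  · filter_upwards [hle] with s hs i
    simpa [norm_smul, b.orthonormal.1] using hs i

variable {U : ℝ → H →L[ℂ] H} {l : ι → ℝ}

/-- The generator maps `A ^ n e ^ (-t A) x` to `A ^ (n + 1) e ^ (-t A) x`: the difference quotients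
are diagonal operators, which converge in operator norm by dominated convergence. -/
theorem tendsto_diffQuot_diagonalOperator (hl : ExpSummable l)
    (hU : ∀ t, 0 ≤ t → ∀ i, U t (b i) = (Real.exp (-(l i * t)) : ℂ) • b i) (n : ℕ) {t : ℝ}
    (ht : 0 < t) (x : H) :
    Tendsto (diffQuot U (diagonalOperator b (fun i => l i ^ n * Real.exp (-(l i * t))) x)) (𝓝[>] 0)
      (𝓝 (diagonalOperator b (fun i => l i ^ (n + 1) * Real.exp (-(l i * t))) x)) := by
  set k : ℝ → ι → ℝ := fun s i =>
    s⁻¹ * (1 - Real.exp (-(l i * s))) * (l i ^ n * Real.exp (-(l i * t))) with hk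
  have hsum (s : ℝ) (hs : 0 < s) : Summable (k s) := by
    refine (((hl.summable_pow n ht).sub (hl.summable_pow n (add_pos ht hs))).mul_left s⁻¹).congr
      fun i => ?_
    rw [hk, mul_add, neg_add, Real.exp_add]
    ring
  have hbound : Summable fun i => 2 * (|l i| ^ (n + 1) * Real.exp (-(l i * t))) +
      |l i| ^ (n + 1) * Real.exp (-(l i * (t + 1))) :=
    ((hl.summable_abs _ ht).mul_left 2).add (hl.summable_abs _ (by positivity))
  have hlim : Tendsto (fun s => diagonalOperator b (k s)) (𝓝[>] 0)
      (𝓝 (diagonalOperator b fun i => l i ^ (n + 1) * Real.exp (-(l i * t)))) := by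
    refine tendsto_diagonalOperator b hbound (fun i => ?_) ?_
    · rw [pow_succ', mul_assoc]
      exact (tendsto_inv_mul_one_sub_exp (l i)).mul_const _
    · filter_upwards [Ioc_mem_nhdsGT one_pos] with s hs i
      have h1 := abs_inv_mul_one_sub_exp_le (l := l i) hs.1 hs.2
      rw [hk, abs_mul, abs_mul (l i ^ n), abs_pow, abs_of_pos (Real.exp_pos _)]
      calc _ ≤ |l i| * (2 + Real.exp (-(l i * 1))) * (|l i| ^ n * Real.exp (-(l i * t))) := by
            gcongr
        _ = _ := by
            rw [mul_add (l i) t 1, neg_add, Real.exp_add]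
            ring
  refine (((ContinuousLinearMap.apply ℂ H x).continuous.tendsto _).comp hlim).congr' ?_
  filter_upwards [self_mem_nhdsWithin] with s hs
  have hs : 0 < s := hs
  refine eq_of_forall_inner_eq b fun i => ?_
  simp only [Function.comp_apply, ContinuousLinearMap.apply_apply, diffQuot]
  rw [inner_apply_of_diagonal b (diagonalOperator_apply_basis b (hsum s hs)), inner_smul_right,
    inner_sub_right, inner_apply_of_diagonal b (hU s hs.le),
    inner_apply_of_diagonal b (diagonalOperator_apply_basis b (hl.summable_pow n ht))]
  simp only [hk]
  push_cast
  ring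

/-- The generator raises the power of `l i` by one, so that `n` applications raise it by `n`. -/
theorem powGraph_diagonalOperator (hl : ExpSummable l)
    (hU : ∀ t, 0 ≤ t → ∀ i, U t (b i) = (Real.exp (-(l i * t)) : ℂ) • b i) (n m : ℕ) {t : ℝ}
    (ht : 0 < t) (x : H) :
    PowGraph (generator U) n (diagonalOperator b (fun i => l i ^ m * Real.exp (-(l i * t))) x)
      (diagonalOperator b (fun i => l i ^ (m + n) * Real.exp (-(l i * t))) x) := by
  induction n generalizing m with
  | zero => rfl
  | succ n ih =>
    refine ⟨_, mem_graph_generator (tendsto_diffQuot_diagonalOperator b hl hU m ht x), ?_⟩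
    rw [← Nat.add_assoc, Nat.add_right_comm]
    exact ih (m + 1)

theorem expSummable_of_isTraceClass (hG : ∀ t, 0 < t → IsTraceClass (U t))
    (hU : ∀ t, 0 ≤ t → ∀ i, U t (b i) = (Real.exp (-(l i * t)) : ℂ) • b i) : ExpSummable l := by
  intro t ht
  obtain ⟨hc, hfin⟩ := hG t ht
  rw [traceNorm_of_diagonal b hc (hU t ht.le)] at hfin
  refine (ENNReal.summable_toReal hfin.ne).congr fun i => ?_
  rw [ENNReal.toReal_ofReal (abs_nonneg _), abs_of_pos (Real.exp_pos _)]

end Generator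

end GibbsSemigroup

theorem theorem5p12 {H : Type*} [NormedAddCommGroup H] [InnerProductSpace ℂ H] [CompleteSpace H]
    [TopologicalSpace.SeparableSpace H] (U : ℝ → H →L[ℂ] H)
    (hGibbs : GibbsSemigroup.IsGibbs U) (hqb : GibbsSemigroup.IsQuasiBounded U)
    (hsa : GibbsSemigroup.IsSelfAdjointSemigroup U) :
    -- the function `F t = ‖e ^ (-t A)‖₁` is smooth on `(0, ∞)`
    ContDiffOn ℝ ∞ (GibbsSemigroup.traceNormFun U) (Set.Ioi 0) ∧
    -- (i) and (ii), with `g t = f (1 / t)`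
    (∀ f ∈ GibbsSemigroup.SR, ∀ n : ℕ,
      (GibbsSemigroup.BigO (𝓝[>] 0) (GibbsSemigroup.traceNormFun U) (fun t => f t⁻¹) →
        GibbsSemigroup.BigO (𝓝[>] 0) (iteratedDeriv n (GibbsSemigroup.traceNormFun U))
          (iteratedDeriv n fun t => f t⁻¹)) ∧
      (GibbsSemigroup.Equivalent (𝓝[>] 0) (GibbsSemigroup.traceNormFun U) (fun t => f t⁻¹) →
        GibbsSemigroup.Equivalent (𝓝[>] 0) (iteratedDeriv n (GibbsSemigroup.traceNormFun U))
          (iteratedDeriv n fun t => f t⁻¹))) ∧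
    -- `B n t = A ^ n e ^ (-t A)` is everywhere defined and trace class for `t > 0`, and its trace
    -- norm is equivalent to the derivative of order `n` of `F`
    ∃ B : ℕ → ℝ → H →L[ℂ] H,
      (∀ (n : ℕ) (t : ℝ), 0 < t →
        (∀ x : H, GibbsSemigroup.PowGraph (GibbsSemigroup.generator U) n (U t x) (B n t x)) ∧
        GibbsSemigroup.IsTraceClass (B n t)) ∧
      (¬ FiniteDimensional ℂ H → ∀ n : ℕ,
        GibbsSemigroup.Equivalent (𝓝[>] 0) (iteratedDeriv n (GibbsSemigroup.traceNormFun U))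
          (fun t => (GibbsSemigroup.traceNorm (B n t)).toReal)) := by
  open GibbsSemigroup in
  obtain ⟨ι, b, l, hU⟩ := exists_eigenbasis hGibbs hsa
  have hl : ExpSummable l := expSummable_of_isTraceClass b hGibbs.2 hU
  have hU' (t : ℝ) (ht : 0 < t) :
      U t = diagonalOperator b fun i => l i ^ 0 * Real.exp (-(l i * t)) :=
    eq_diagonalOperator b (hl.summable_pow 0 ht) fun i => by simpa using hU t ht.le i
  have hnorm (n : ℕ) (t : ℝ) (ht : 0 < t) :
      (traceNorm (diagonalOperator b fun i => l i ^ n * Real.exp (-(l i * t)))).toReal =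
        absExpSum l n t := by
    rw [traceNorm_diagonalOperator_toReal b (hl.summable_pow n ht)]
    refine tsum_congr fun i => ?_
    rw [abs_mul, abs_pow, abs_of_pos (Real.exp_pos _)]
  have hF (t : ℝ) (ht : 0 < t) : traceNormFun U t = expSum l 0 t := by
    rw [traceNormFun, hU' t ht, hnorm 0 t ht]
    simp [absExpSum, expSum]
  have hFn (n : ℕ) : expSum l n =ᶠ[𝓝[>] 0] iteratedDeriv n (traceNormFun U) := by
    filter_upwards [self_mem_nhdsWithin] with t ht using (hl.iteratedDeriv_eq hF n ht).symm
  have hF0 : traceNormFun U =ᶠ[𝓝[>] 0] expSum l 0 := by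
    simpa using (hFn 0).symm
  refine ⟨hl.contDiffOn hF, ?_, fun n t =>
    diagonalOperator b fun i => l i ^ n * Real.exp (-(l i * t)), fun n t ht => ⟨fun x => ?_,
      isTraceClass_diagonalOperator b (hl.summable_pow n ht)⟩, fun hfin n => ?_⟩
  · rintro f ⟨p, hp, hf⟩ n
    have hg := hf.atZero hp
    refine ⟨fun h => ?_, fun h => (hl.equivalent_iteratedDeriv hp hg (h.congr hF0) n).congr (hFn n)⟩
    exact (hl.bigO_iteratedDeriv hp hg (h.congr hF0) n).congr (hFn n)
  · rw [hU' t ht]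
    simpa using powGraph_diagonalOperator b hl hU n 0 ht x
  · have : Infinite ι := by
      by_contra hι
      have := not_infinite_iff_finite.mp hι
      have := Fintype.ofFinite ι
      exact hfin (Module.Basis.finiteDimensional_of_finite b.toOrthonormalBasis.toBasis)
    refine Tendsto.congr' ?_ (hl.equivalent_absExpSum n)
    filter_upwards [hFn n, self_mem_nhdsWithin] with t h1 ht
    rw [h1, hnorm n t ht]
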